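/- Let $m,r,q,l\ge 0$ be integers, $H$ a probability distribution on $(0,\infty)$ with $k_1=\int u^{-1/2}\,dH(u)<\infty$, $\mathbf X_i\in\mathbb R^{m\times l}$, $\mathbf X_i^+\in\mathbb R^{r\times l}$, $\mathbf Z_i\in\mathbb R^{m\times q}$, $\mathbf Z_i^+\in\mathbb R^{r\times q}$ design matrices, $\boldsymbol\beta\in\mathbb R^l$, $\boldsymbol\lambda\in\mathbb R^q$, and $\mathbf D\in\mathbb R^{q\times q}$, $\boldsymbol\Sigma_i^*\in\mathbb R^{(m+r)\times(m+r)}$ symmetric positive definite. Put $$c=-\sqrt{2/\pi}\,k_1,\quad \boldsymbol\Delta=\frac{\mathbf D^{1/2}\boldsymbol\lambda}{\sqrt{1+\boldsymbol\lambda^\top\boldsymbol\lambda}},\quad \boldsymbol\zeta=\mathbf D^{-1/2}\boldsymbol\lambda,\quad \mathbf X_i^*=\begin{pmatrix}\mathbf X_i\\ \mathbf X_i^+\end{pmatrix},\quad \mathbf Z_i^*=\begin{pmatrix}\mathbf Z_i\\ \mathbf Z_i^+\end{pmatrix},$$ $$\boldsymbol\Psi_i^*=\boldsymbol\Sigma_i^*+\mathbf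 Z_i^*\mathbf D\mathbf Z_i^{*\top}=\begin{pmatrix}\boldsymbol\Psi^*_{i11}&\boldsymbol\Psi^*_{i12}\\ \boldsymbol\Psi^*_{i21}&\boldsymbol\Psi^*_{i22}\end{pmatrix},\quad \boldsymbol\Lambda_i^*=(\mathbf D^{-1}+\mathbf Z_i^{*\top}\boldsymbol\Sigma_i^{*-1}\mathbf Z_i^*)^{-1},\quad \bar{\boldsymbol\lambda}_i^*=\frac{\boldsymbol\Psi_i^{*-1/2}\mathbf Z_i^*\mathbf D\boldsymbol\zeta}{\sqrt{1+\boldsymbol\zeta^\top\boldsymbol\Lambda_i^*\boldsymbol\zeta}},$$ where all matrix square roots are the positive semidefinite ones. Suppose that the observed vector $\mathbf Y_i\in\mathbb R^m$ and the future vector $\mathbf Y_i^+\in\mathbb R^r$ satisfy $$\begin{pmatrix}\mathbf Y_i\\ \mathbf Y_i^+\end{pmatrix}\sim \mathrm{SMSN}_{m+r}\left(\mathbf X_i^*\boldsymbol\beta+c\,\mathbf Z_i^*\boldsymbol\Delta,\ \boldsymbol\Psi_i^*,\ \bar{\boldsymbol\lambda}_i^*;\ H\right)$$ with scale mixing variable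 $U_i$. Here $\mathbf V\sim\mathrm{SMSN}_p(\boldsymbol\mu,\boldsymbol\Sigma,\boldsymbol\lambda;H)$ with mixing variable $U$ means that $U\sim H$ and that, given $U=u$, $\mathbf V$ has the density $2\,\phi_p(\mathbf v;\boldsymbol\mu,u^{-1}\boldsymbol\Sigma)\,\Phi\!\left(u^{1/2}\boldsymbol\lambda^\top\boldsymbol\Sigma^{-1/2}(\mathbf v-\boldsymbol\mu)\right)$, where $\phi_p(\cdot;\boldsymbol\mu,\boldsymbol\Sigma)$ is the $p$-variate normal density with mean $\boldsymbol\mu$ and covariance matrix $\boldsymbol\Sigma$, and $\Phi$ is the standard normal cdf. Let the observations $\mathbf Y_{(i)}$ of the other subjects be independent of $(\mathbf Y_i,\mathbf Y_i^+)$. Write $\boldsymbol\upsilon_i=\boldsymbol\Psi_i^{*-1/2}\bar{\boldsymbol\lambda}_i^*=(\boldsymbol\upsilon_i^{(1)\top},\boldsymbol\upsilon_i^{(2)\top})^\top$ (blocks of sizes $m$ and $r$), $\boldsymbol\Psi^*_{i22.1}=\boldsymbol\Psi^*_{i22}-\boldsymbol\Psi^*_{i21}\boldsymbol\Psi_{i11}^{*-1}\boldsymbol\Psi^*_{i12}$,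 $$\widetilde{\boldsymbol\upsilon}_i=\frac{\boldsymbol\upsilon_i^{(1)}+\boldsymbol\Psi_{i11}^{*-1}\boldsymbol\Psi^*_{i12}\boldsymbol\upsilon_i^{(2)}}{\sqrt{1+\boldsymbol\upsilon_i^{(2)\top}\boldsymbol\Psi^*_{i22.1}\boldsymbol\upsilon_i^{(2)}}},\qquad W_\Phi=\phi_1/\Phi$$ with $\phi_1$ the standard normal density, $$\boldsymbol\mu_{i2.1}(\mathbf y_i)=\mathbf X_i^+\boldsymbol\beta+c\,\mathbf Z_i^+\boldsymbol\Delta+\boldsymbol\Psi^*_{i21}\boldsymbol\Psi_{i11}^{*-1}(\mathbf y_i-\mathbf X_i\boldsymbol\beta-c\,\mathbf Z_i\boldsymbol\Delta),$$ $$\widetilde\tau_{-1i}(\mathbf y_i)=\mathrm E\left\{U_i^{-1/2}\,W_\Phi\!\left(U_i^{1/2}\,\widetilde{\boldsymbol\upsilon}_i^\top(\mathbf Y_i-\mathbf X_i\boldsymbol\beta-c\,\mathbf Z_i\boldsymbol\Delta)\right)\,\middle|\,\mathbf Y_i=\mathbf y_i\right\}.$$ Then, for almost every $\mathbf y_i$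 with respect to the law of $\mathbf Y_i$, the conditional expectations $\mathrm E\{\mathbf Y_i^+\mid\mathbf Y_i=\mathbf y_i\}$ and $\widetilde\tau_{-1i}(\mathbf y_i)$ exist, and $$\mathrm E\{\mathbf Y_i^+\mid\mathbf Y_i=\mathbf y_i\}=\boldsymbol\mu_{i2.1}(\mathbf y_i)+\frac{\widetilde\tau_{-1i}(\mathbf y_i)\,\boldsymbol\Psi^*_{i22.1}\boldsymbol\upsilon_i^{(2)}}{\sqrt{1+\boldsymbol\upsilon_i^{(2)\top}\boldsymbol\Psi^*_{i22.1}\boldsymbol\upsilon_i^{(2)}}}=:\widehat{\mathbf Y}_i^+(\mathbf y_i).$$ Moreover $\widehat{\mathbf Y}_i^+(\mathbf Y_i)$ is the minimum mean squared error predictor of $\mathbf Y_i^+$, both among the measurable functions of $\mathbf Y_i$ and among the measurable functions of all the data $(\mathbf Y_i,\mathbf Y_{(i)})$: no such function $g$ has a smaller error $\mathrm E\|\mathbf Y_i^+-g\|^2\in[0,\infty]$, and any $g$ of finite error that does as well equals $\widehat{\mathbf Y}_i^+(\mathbf Y_i)$ almost surely. -/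

import Mathlib

open MeasureTheory ProbabilityTheory Matrix
open scoped MatrixOrder ENNReal

noncomputable section

namespace SMSN

/-- The cdf `Φ` of the standard normal distribution. -/
def Phi (x : ℝ) : ℝ := cdf (gaussianReal 0 1) x

/-- `W_Φ(x) = φ₁(x) / Φ(x)`. -/
def WPhi (x : ℝ) : ℝ := gaussianPDFReal 0 1 x / Phi x

section Density

variable {ι : Type*} [Fintype ι] [DecidableEq ι]

/-- The density `φ_p(y; μ, S)` of the `p`-variate normal distribution with mean `μ` and
covariance matrix `S`, where `p` is the number of elements of `ι`. -/
def normalPDF (mu : ι → ℝ) (S : Matrix ι ι ℝ) (y : ι → ℝ) : ℝ :=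
  (√((2 * Real.pi) ^ Fintype.card ι * S.det))⁻¹ *
    Real.exp (-((y - mu) ⬝ᵥ (S⁻¹ *ᵥ (y - mu))) / 2)

/-- The conditional density of `Y` given `U = u`, that is, of `SN_p(μ, u⁻¹ S, lam)`:
`2 φ_p(y; μ, u⁻¹ S) Φ(u^{1/2} lamᵀ S^{-1/2} (y - μ))`. Here `S^{-1/2}` is the positive
semidefinite square root of `S⁻¹`. -/
def condPDF (mu : ι → ℝ) (S : Matrix ι ι ℝ) (lam : ι → ℝ) (u : ℝ) (y : ι → ℝ) : ℝ :=
  2 * normalPDF mu (u⁻¹ • S) y * Phi (√u * (lam ⬝ᵥ (CFC.sqrt S⁻¹ *ᵥ (y - mu))))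

/-- The density of `SMSN_p(μ, S, lam; H)`: the mixture `∫ condPDF μ S lam u y dH(u)`. -/
def pdf (mu : ι → ℝ) (S : Matrix ι ι ℝ) (lam : ι → ℝ) (H : Measure ℝ) (y : ι → ℝ) : ℝ≥0∞ :=
  ∫⁻ u, ENNReal.ofReal (condPDF mu S lam u y) ∂H

/-- `Y ∼ SMSN_p(μ, S, lam; H)` with scale mixing variable `U`: `U` has distribution `H`, and the
conditional law of `Y` given `U = u` has the density `condPDF μ S lam u`; the pair `(U, Y)` thus
has the density `(u, y) ↦ condPDF μ S lam u y` with respect to the product of `H` and the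
Lebesgue measure. In particular `Y` has the density `pdf μ S lam H`
(see `IsSMSN.map_eq_withDensity_pdf`). -/
structure IsSMSN {Ω : Type*} [MeasurableSpace Ω] (P : Measure Ω) (Y : Ω → ι → ℝ) (U : Ω → ℝ)
    (mu : ι → ℝ) (S : Matrix ι ι ℝ) (lam : ι → ℝ) (H : Measure ℝ) : Prop where
  map_mixing : P.map U = H
  map_joint : P.map (fun ω => (U ω, Y ω)) =
    (H.prod (volume : Measure (ι → ℝ))).withDensity
      (fun p => ENNReal.ofReal (condPDF mu S lam p.1 p.2))

theorem measurable_Phi : Measurable Phi := (monotone_cdf _).measurable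

theorem measurable_condPDF (mu : ι → ℝ) (S : Matrix ι ι ℝ) (lam : ι → ℝ) :
    Measurable (fun p : ℝ × (ι → ℝ) => condPDF mu S lam p.1 p.2) := by
  have hinv : ∀ u : ℝ, (u⁻¹ • S)⁻¹ = Ring.inverse (u⁻¹ • S).det • (u⁻¹ • S).adjugate :=
    fun u => Matrix.inv_def _
  have hsub : ∀ i, Measurable (fun p : ℝ × (ι → ℝ) => p.2 i - mu i) := fun i => by fun_prop
  unfold condPDF normalPDF
  refine (measurable_const.mul (Measurable.mul ?_ ?_)).mul (measurable_Phi.comp ?_)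
  · simp only [Matrix.det_smul]
    fun_prop
  · simp only [hinv, Ring.inverse_eq_inv', Matrix.det_smul, Matrix.adjugate_smul, dotProduct,
      mulVec, Matrix.smul_apply, smul_eq_mul, Pi.sub_apply]
    fun_prop
  · simp only [dotProduct, mulVec, Pi.sub_apply]
    fun_prop

/-- An `SMSN` vector has the `SMSN` density. -/
theorem IsSMSN.map_eq_withDensity_pdf {Ω : Type*} [MeasurableSpace Ω] {P : Measure Ω}
    {Y : Ω → ι → ℝ} {U : Ω → ℝ} {mu : ι → ℝ} {S : Matrix ι ι ℝ} {lam : ι → ℝ} {H : Measure ℝ}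
    [SFinite H] (hY : Measurable Y) (hU : Measurable U) (h : IsSMSN P Y U mu S lam H) :
    P.map Y = volume.withDensity (pdf mu S lam H) := by
  have h1 : P.map Y = (P.map (fun ω => (U ω, Y ω))).map Prod.snd := by
    rw [Measure.map_map measurable_snd (hU.prodMk hY)]
    rfl
  have hm : Measurable (fun p : ℝ × (ι → ℝ) => ENNReal.ofReal (condPDF mu S lam p.1 p.2)) :=
    (measurable_condPDF mu S lam).ennreal_ofReal
  rw [h1, h.map_joint]
  ext s hs
  rw [Measure.map_apply measurable_snd hs, withDensity_apply _ (measurable_snd hs),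
    withDensity_apply _ hs, ← Set.univ_prod, ← Measure.prod_restrict,
    Measure.restrict_univ, lintegral_prod_symm _ hm.aemeasurable]
  rfl

end Density

/-- The parameters of the linear mixed model for one subject with `m` observed and `r` future
measurements, `l` fixed effects and `q` random effects. `Sigma` is the error dispersion matrix of
the stacked vector of all `m + r` measurements. -/
structure Model (l q m r : ℕ) where
  X : Matrix (Fin m) (Fin l) ℝ
  Xp : Matrix (Fin r) (Fin l) ℝ
  Z : Matrix (Fin m) (Fin q) ℝ
  Zp : Matrix (Fin r) (Fin q) ℝ
  beta : Fin l → ℝ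
  D : Matrix (Fin q) (Fin q) ℝ
  lam : Fin q → ℝ
  Sigma : Matrix (Fin m ⊕ Fin r) (Fin m ⊕ Fin r) ℝ
  H : Measure ℝ

namespace Model

variable {l q m r : ℕ} (M : Model l q m r)

/-- `k₁ = E U^{-1/2}`. -/
def k₁ : ℝ := ∫ u, (√u)⁻¹ ∂M.H

/-- `c = -√(2/π) k₁`. -/
def c : ℝ := -√(2 / Real.pi) * M.k₁

/-- `δ = lam / √(1 + lamᵀ lam)`. -/
def delta : Fin q → ℝ := (√(1 + M.lam ⬝ᵥ M.lam))⁻¹ • M.lam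

/-- `Δ = D^{1/2} δ`. -/
def Delta : Fin q → ℝ := CFC.sqrt M.D *ᵥ M.delta

/-- `ζ = D^{-1/2} lam`. -/
def zeta : Fin q → ℝ := CFC.sqrt M.D⁻¹ *ᵥ M.lam

/-- The stacked design matrix `X*`. -/
def Xstar : Matrix (Fin m ⊕ Fin r) (Fin l) ℝ := fromRows M.X M.Xp

/-- The stacked design matrix `Z*`. -/
def Zstar : Matrix (Fin m ⊕ Fin r) (Fin q) ℝ := fromRows M.Z M.Zp

/-- The location vector `X* β + c Z* Δ`. -/
def loc : Fin m ⊕ Fin r → ℝ := M.Xstar *ᵥ M.beta + M.c • (M.Zstar *ᵥ M.Delta)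

/-- `Ψ* = Σ* + Z* D Z*ᵀ`. -/
def Psi : Matrix (Fin m ⊕ Fin r) (Fin m ⊕ Fin r) ℝ := M.Sigma + M.Zstar * M.D * M.Zstarᵀ

/-- `Λ* = (D⁻¹ + Z*ᵀ Σ*⁻¹ Z*)⁻¹`. -/
def Lambda : Matrix (Fin q) (Fin q) ℝ := (M.D⁻¹ + M.Zstarᵀ * M.Sigma⁻¹ * M.Zstar)⁻¹

/-- The skewness vector `Ψ*^{-1/2} Z* D ζ / √(1 + ζᵀ Λ* ζ)` of the stacked vector. -/
def lamBar : Fin m ⊕ Fin r → ℝ :=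
  (√(1 + M.zeta ⬝ᵥ (M.Lambda *ᵥ M.zeta)))⁻¹ •
    (CFC.sqrt M.Psi⁻¹ *ᵥ (M.Zstar *ᵥ (M.D *ᵥ M.zeta)))

/-- `Ψ*₁₁`. -/
def Psi11 : Matrix (Fin m) (Fin m) ℝ := M.Psi.toBlocks₁₁
/-- `Ψ*₁₂`. -/
def Psi12 : Matrix (Fin m) (Fin r) ℝ := M.Psi.toBlocks₁₂
/-- `Ψ*₂₁`. -/
def Psi21 : Matrix (Fin r) (Fin m) ℝ := M.Psi.toBlocks₂₁
/-- `Ψ*₂₂`. -/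
def Psi22 : Matrix (Fin r) (Fin r) ℝ := M.Psi.toBlocks₂₂

/-- `Ψ*₂₂.₁ = Ψ*₂₂ - Ψ*₂₁ Ψ*₁₁⁻¹ Ψ*₁₂`. -/
def Psi22_1 : Matrix (Fin r) (Fin r) ℝ := M.Psi22 - M.Psi21 * M.Psi11⁻¹ * M.Psi12

/-- `υ = Ψ*^{-1/2} lamBar`. -/
def upsilon : Fin m ⊕ Fin r → ℝ := CFC.sqrt M.Psi⁻¹ *ᵥ M.lamBar
/-- `υ⁽¹⁾`. -/
def upsilon1 : Fin m → ℝ := fun j => M.upsilon (Sum.inl j)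
/-- `υ⁽²⁾`. -/
def upsilon2 : Fin r → ℝ := fun j => M.upsilon (Sum.inr j)

/-- `√(1 + υ⁽²⁾ᵀ Ψ*₂₂.₁ υ⁽²⁾)`. -/
def scale : ℝ := √(1 + M.upsilon2 ⬝ᵥ (M.Psi22_1 *ᵥ M.upsilon2))

/-- `υ̃ = (υ⁽¹⁾ + Ψ*₁₁⁻¹ Ψ*₁₂ υ⁽²⁾) / √(1 + υ⁽²⁾ᵀ Ψ*₂₂.₁ υ⁽²⁾)`. -/
def upsilonTilde : Fin m → ℝ :=
  M.scale⁻¹ • (M.upsilon1 + M.Psi11⁻¹ *ᵥ (M.Psi12 *ᵥ M.upsilon2))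

/-- The centred observation `y - X β - c Z Δ`. -/
def resid (y : Fin m → ℝ) : Fin m → ℝ := y - M.X *ᵥ M.beta - M.c • (M.Z *ᵥ M.Delta)

/-- `μ₂.₁ = X⁺ β + c Z⁺ Δ + Ψ*₂₁ Ψ*₁₁⁻¹ (y - X β - c Z Δ)`. -/
def mu2_1 (y : Fin m → ℝ) : Fin r → ℝ :=
  M.Xp *ᵥ M.beta + M.c • (M.Zp *ᵥ M.Delta) + M.Psi21 *ᵥ (M.Psi11⁻¹ *ᵥ M.resid y)

/-- `u^{-1/2} W_Φ(u^{1/2} υ̃ᵀ (y - X β - c Z Δ))`. -/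
def tauIntegrand (y : Fin m → ℝ) (u : ℝ) : ℝ :=
  (√u)⁻¹ * WPhi (√u * (M.upsilonTilde ⬝ᵥ M.resid y))

/-- `τ̃₋₁(y) = E[U^{-1/2} W_Φ(U^{1/2} υ̃ᵀ (Y - X β - c Z Δ)) | Y = y]`. -/
def tauTilde {Ω : Type*} [MeasurableSpace Ω] (P : Measure Ω) [IsFiniteMeasure P]
    (Y : Ω → Fin m → ℝ) (U : Ω → ℝ) (y : Fin m → ℝ) : ℝ :=
  ∫ u, M.tauIntegrand y u ∂(condDistrib U Y P y)

/-- The predictor `μ₂.₁ + τ̃₋₁ Ψ*₂₂.₁ υ⁽²⁾ / √(1 + υ⁽²⁾ᵀ Ψ*₂₂.₁ υ⁽²⁾)` at the observation `y`. -/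
def predictor {Ω : Type*} [MeasurableSpace Ω] (P : Measure Ω) [IsFiniteMeasure P]
    (Y : Ω → Fin m → ℝ) (U : Ω → ℝ) (y : Fin m → ℝ) : Fin r → ℝ :=
  M.mu2_1 y + (M.tauTilde P Y U y / M.scale) • (M.Psi22_1 *ᵥ M.upsilon2)

end Model

/-- The mean squared (Euclidean) error `E ‖V - W‖²` of `W` as a predictor of `V`. -/
def mse {Ω : Type*} [MeasurableSpace Ω] (P : Measure Ω) {r : ℕ} (V W : Ω → Fin r → ℝ) : ℝ≥0∞ :=
  ∫⁻ ω, ENNReal.ofReal (∑ j, (V ω j - W ω j) ^ 2) ∂P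

/-- `f(T)` has minimum mean squared error among all predictors `g(T)` of `V` from the data `T`,
and every predictor `g(T)` of finite mean squared error that does as well agrees with it almost
surely. -/
structure IsMinMSEPredictor {Ω 𝓣 : Type*} [MeasurableSpace Ω] [MeasurableSpace 𝓣] (P : Measure Ω)
    {r : ℕ} (V : Ω → Fin r → ℝ) (T : Ω → 𝓣) (f : 𝓣 → Fin r → ℝ) : Prop where
  measurable : Measurable f
  le : ∀ g : 𝓣 → Fin r → ℝ, Measurable g →
    mse P V (fun ω => f (T ω)) ≤ mse P V (fun ω => g (T ω))
  unique : ∀ g : 𝓣 → Fin r → ℝ, Measurable g → mse P V (fun ω => g (T ω)) ≠ ∞ →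
    mse P V (fun ω => g (T ω)) ≤ mse P V (fun ω => f (T ω)) →
    ∀ᵐ ω ∂P, g (T ω) = f (T ω)

end SMSN

end

/-!
Given `U = u`, the vector `√u (V - μ)` has the centred normal law `N(0, S)` tilted by the factor
`2 Φ(υᵀ w)`. Under `N(0, S)` the regression residual `R` of the second block is independent of the
first block, and `υᵀ w = s · υ̃ᵀ w₁ + υ₂ᵀ R` with `s = √(1 + Var(υ₂ᵀ R))`. Writing `Φ` as the
distribution function of an independent standard normal variable gives, for jointly normal centred
`R` and `V`, `E Φ(t + V) = Φ(t / s)` and `E R Φ(t + V) = cov(R, V) / s · φ₁(t / s)`, whose quotient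
at `t = s τ` is `cov(R, V) / s · W_Φ(τ)`. Hence the residual has the same integral as
`W_Φ(υ̃ᵀ w₁) S₂₂.₁ υ₂ / s` over every event of the first block; rescaling by `u^{-1/2}` and
integrating over the mixing variable identifies the conditional mean of the second block. A
conditional mean minimises the mean squared error by Pythagoras, and it does not change when data
independent of both blocks are added to the condition.
-/

noncomputable section

namespace SMSN

section Phi

theorem Phi_eq (t : ℝ) : Phi t = (gaussianReal 0 1).real (Set.Iic t) := cdf_eq_real _ _

theorem Phi_nonneg (t : ℝ) : 0 ≤ Phi t := cdf_nonneg _ _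

theorem Phi_le_one (t : ℝ) : Phi t ≤ 1 := cdf_le_one _ _

theorem norm_Phi_le_one (x : ℝ) : ‖Phi x‖ ≤ 1 := by
  rw [Real.norm_of_nonneg (Phi_nonneg x)]
  exact Phi_le_one x

theorem Phi_pos (t : ℝ) : 0 < Phi t := by
  rw [Phi_eq, measureReal_def]
  refine ENNReal.toReal_pos (fun h => ?_) (measure_ne_top _ _)
  simpa using gaussianReal_absolutelyContinuous' 0 one_ne_zero h

theorem measurable_WPhi : Measurable WPhi := (measurable_gaussianPDFReal 0 1).div measurable_Phi

theorem WPhi_nonneg (t : ℝ) : 0 ≤ WPhi t :=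
  div_nonneg (gaussianPDFReal_nonneg _ _ _) (Phi_nonneg t)

theorem Phi_mul_WPhi (t : ℝ) : Phi t * WPhi t = gaussianPDFReal 0 1 t :=
  mul_div_cancel₀ _ (Phi_pos t).ne'

theorem gaussianPDFReal_zero_one (x : ℝ) :
    gaussianPDFReal 0 1 x = (√(2 * Real.pi))⁻¹ * Real.exp (-x ^ 2 / 2) := by
  simp [gaussianPDFReal]

theorem gaussianPDFReal_zero_one_le_one (t : ℝ) : gaussianPDFReal 0 1 t ≤ 1 := by
  rw [gaussianPDFReal_zero_one]
  refine mul_le_one₀ (inv_le_one_of_one_le₀ ?_) (Real.exp_nonneg _) (Real.exp_le_one_iff.2 ?_)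
  · rw [Real.one_le_sqrt]
    linarith [Real.two_le_pi]
  · linarith [sq_nonneg t]

theorem hasDerivAt_neg_gaussianPDFReal_zero_one (x : ℝ) :
    HasDerivAt (fun x => -gaussianPDFReal 0 1 x) (gaussianPDFReal 0 1 x * x) x := by
  simp only [gaussianPDFReal_zero_one]
  have h : HasDerivAt (fun x : ℝ => -x ^ 2 / 2) (-x) x :=
    (((hasDerivAt_id x).pow 2).neg.div_const 2).congr_deriv (by simp; ring)
  exact (h.exp.const_mul _).neg.congr_deriv (by ring)

theorem tendsto_gaussianPDFReal_zero_one_atBot :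
    Filter.Tendsto (gaussianPDFReal 0 1) Filter.atBot (nhds 0) := by
  have hsq : Filter.Tendsto (fun x : ℝ => -x ^ 2 / 2) Filter.atBot Filter.atBot := by
    refine Filter.tendsto_atBot_mono' _ ?_ Filter.tendsto_id
    filter_upwards [Filter.eventually_le_atBot (-2)] with x hx
    simp only [id]
    nlinarith
  rw [funext gaussianPDFReal_zero_one, ← mul_zero (√(2 * Real.pi))⁻¹]
  exact (Real.tendsto_exp_atBot.comp hsq).const_mul _

theorem setIntegral_Iic_id_gaussianReal (t : ℝ) :
    ∫ x in Set.Iic t, x ∂(gaussianReal 0 1) = -gaussianPDFReal 0 1 t := by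
  have hint : Integrable (fun x : ℝ => gaussianPDFReal 0 1 x * x) := by
    have h := (memLp_id_gaussianReal (μ := 0) (v := 1) 1).integrable le_rfl
    rw [gaussianReal_of_var_ne_zero 0 one_ne_zero,
      integrable_withDensity_iff_integrable_smul' (measurable_gaussianPDF _ _)
      (by simp [gaussianPDF_lt_top])] at h
    simpa [toReal_gaussianPDF] using h
  have htend := tendsto_gaussianPDFReal_zero_one_atBot.neg
  rw [gaussianReal_of_var_ne_zero 0 one_ne_zero,
    setIntegral_withDensity_eq_setIntegral_toReal_smul (measurable_gaussianPDF _ _)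
      (by simp [gaussianPDF_lt_top]) _ measurableSet_Iic]
  simp only [toReal_gaussianPDF, smul_eq_mul]
  rw [integral_Iic_of_hasDerivAt_of_tendsto'
    (fun x _ => hasDerivAt_neg_gaussianPDFReal_zero_one x) hint.integrableOn htend]
  simp

end Phi

section Probit

theorem setOf_le_eq_preimage_div {α : Type*} (W : α → ℝ) (t : ℝ) {σ : ℝ} (hσ : 0 < σ) :
    {x | W x ≤ t} = (fun x => W x / σ) ⁻¹' Set.Iic (t / σ) := by
  ext x
  simp [div_le_div_iff_of_pos_right hσ]

variable {Ω : Type*} [MeasurableSpace Ω] {μ : Measure Ω}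

theorem hasLaw_div_sqrt_variance {W : Ω → ℝ} (hW : HasGaussianLaw W μ) (hW0 : μ[W] = 0)
    (hvar : 0 < Var[W; μ]) : HasLaw (fun ω => W ω / √Var[W; μ]) (gaussianReal 0 1) μ := by
  have hlaw : HasLaw W (gaussianReal 0 Var[W; μ].toNNReal) μ :=
    ⟨hW.aemeasurable, by rw [hW.map_eq_gaussianReal, hW0]⟩
  convert gaussianReal_div_const hlaw √Var[W; μ] using 2
  · simp
  · ext
    simp [Real.sq_sqrt hvar.le, hvar.le, hvar.ne']

theorem measureReal_le_eq_Phi {W : Ω → ℝ} (hW : HasGaussianLaw W μ) (hW0 : μ[W] = 0)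
    (hvar : 0 < Var[W; μ]) (t : ℝ) : μ.real {ω | W ω ≤ t} = Phi (t / √Var[W; μ]) := by
  have hlaw := hasLaw_div_sqrt_variance hW hW0 hvar
  rw [Phi_eq, ← hlaw.map_eq, setOf_le_eq_preimage_div W t (Real.sqrt_pos.2 hvar),
    map_measureReal_apply_of_aemeasurable hlaw.aemeasurable measurableSet_Iic]

theorem setIntegral_le_self {W : Ω → ℝ} (hW : HasGaussianLaw W μ) (hW0 : μ[W] = 0)
    (hvar : 0 < Var[W; μ]) (t : ℝ) :
    ∫ ω in {ω | W ω ≤ t}, W ω ∂μ = -(√Var[W; μ] * gaussianPDFReal 0 1 (t / √Var[W; μ])) := by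
  have hσ : 0 < √Var[W; μ] := Real.sqrt_pos.2 hvar
  have hlaw := hasLaw_div_sqrt_variance hW hW0 hvar
  have hstd : ∫ ω in {ω | W ω ≤ t}, W ω / √Var[W; μ] ∂μ =
      -gaussianPDFReal 0 1 (t / √Var[W; μ]) := by
    rw [setOf_le_eq_preimage_div W t hσ, ← setIntegral_Iic_id_gaussianReal, ← hlaw.map_eq,
      setIntegral_map (f := fun x => x) measurableSet_Iic aestronglyMeasurable_id
        hlaw.aemeasurable]
  rw [integral_div, div_eq_iff hσ.ne'] at hstd
  rw [hstd]
  ring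

theorem setIntegral_le_of_hasGaussianLaw {X W : Ω → ℝ}
    (hXW : HasGaussianLaw (fun ω => (X ω, W ω)) μ) (hX0 : μ[X] = 0) (hW0 : μ[W] = 0)
    (hvar : 0 < Var[W; μ]) (t : ℝ) :
    ∫ ω in {ω | W ω ≤ t}, X ω ∂μ =
      -(cov[X, W; μ] / √Var[W; μ] * gaussianPDFReal 0 1 (t / √Var[W; μ])) := by
  have := hXW.isProbabilityMeasure
  set a : ℝ := cov[X, W; μ] / Var[W; μ] with ha
  have hXW' : HasGaussianLaw (fun ω => (X ω - a * W ω, W ω)) μ :=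
    hXW.map_fun ((ContinuousLinearMap.fst ℝ ℝ ℝ - a • ContinuousLinearMap.snd ℝ ℝ ℝ).prod
      (ContinuousLinearMap.snd ℝ ℝ ℝ))
  have hcov : cov[fun ω => X ω - a * W ω, W; μ] = 0 := by
    rw [covariance_fun_sub_left hXW.fst.memLp_two (hXW.snd.memLp_two.const_mul a)
      hXW.snd.memLp_two, covariance_const_mul_left, covariance_self hXW.snd.aemeasurable, ha,
      div_mul_cancel₀ _ hvar.ne', sub_self]
  have hmean : ∫ ω, X ω - a * W ω ∂μ = 0 := by
    rw [integral_sub hXW.fst.integrable (hXW.snd.integrable.const_mul a), integral_const_mul,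
      hX0, hW0, mul_zero, sub_zero]
  have hset : NullMeasurableSet {ω | W ω ≤ t} μ :=
    hXW.snd.aemeasurable.nullMeasurable measurableSet_Iic
  have hindep := (hXW'.indepFun_of_covariance_eq_zero hcov).integral_fun_comp_mul_comp
    (f := id) (g := (Set.Iic t).indicator 1) hXW'.fst.aemeasurable hXW.snd.aemeasurable
    aestronglyMeasurable_id (aestronglyMeasurable_one.indicator measurableSet_Iic)
  have hzero : ∫ ω in {ω | W ω ≤ t}, (X ω - a * W ω) ∂μ = 0 := by
    rw [← integral_indicator₀ hset]
    simpa [hmean, Set.indicator_apply] using hindep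
  rw [integral_sub hXW.fst.integrable.integrableOn
    (hXW.snd.integrable.const_mul a).integrableOn, integral_const_mul,
    setIntegral_le_self hXW.snd hW0 hvar, sub_eq_zero] at hzero
  rw [hzero, ha, mul_neg, ← mul_assoc, div_mul_eq_mul_div, mul_div_assoc, Real.sqrt_div_self,
    ← div_eq_mul_inv]

theorem hasGaussianLaw_prodMk_snd_sub {R V : Ω → ℝ}
    (hRV : HasGaussianLaw (fun ω => (R ω, V ω)) μ) :
    HasGaussianLaw (fun p : Ω × ℝ => (R p.1, p.2 - V p.1)) (μ.prod (gaussianReal 0 1)) := by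
  have := hRV.isProbabilityMeasure
  have hfst : HasGaussianLaw (fun p : Ω × ℝ => (R p.1, V p.1)) (μ.prod (gaussianReal 0 1)) := by
    have hmap := (measurePreserving_fst (μ := μ) (ν := gaussianReal 0 1)).map_eq
    have hgauss := hRV.isGaussian_map
    rw [← hmap, AEMeasurable.map_map_of_aemeasurable (by rw [hmap]; exact hRV.aemeasurable)
      (by fun_prop)] at hgauss
    exact ⟨hgauss⟩
  have hsnd : HasGaussianLaw (fun p : Ω × ℝ => p.2) (μ.prod (gaussianReal 0 1)) := by
    refine ⟨?_⟩
    rw [measurePreserving_snd.map_eq]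
    infer_instance
  have hindep : IndepFun (fun p : Ω × ℝ => (R p.1, V p.1)) (fun p => p.2)
      (μ.prod (gaussianReal 0 1)) :=
    indepFun_prod₀ hRV.aemeasurable aemeasurable_id
  exact (hindep.hasGaussianLaw hfst hsnd).map_fun
    (((ContinuousLinearMap.fst ℝ ℝ ℝ).comp (ContinuousLinearMap.fst ℝ (ℝ × ℝ) ℝ)).prod
      (ContinuousLinearMap.snd ℝ (ℝ × ℝ) ℝ -
        (ContinuousLinearMap.snd ℝ ℝ ℝ).comp (ContinuousLinearMap.fst ℝ (ℝ × ℝ) ℝ)))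

theorem integral_snd_sub [IsProbabilityMeasure μ] {V : Ω → ℝ} (hV : Integrable V μ) :
    ∫ p : Ω × ℝ, (p.2 - V p.1) ∂(μ.prod (gaussianReal 0 1)) = -∫ ω, V ω ∂μ := by
  have hid : Integrable (fun x : ℝ => x) (gaussianReal 0 1) :=
    (memLp_id_gaussianReal 1).integrable le_rfl
  rw [integral_sub (hid.comp_snd μ) (hV.comp_fst _), integral_fun_snd (f := fun x : ℝ => x),
    integral_fun_fst (f := V)]
  simp

theorem variance_snd_sub [IsProbabilityMeasure μ] {V : Ω → ℝ} (hV : MemLp V 2 μ) :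
    Var[fun p : Ω × ℝ => p.2 - V p.1; μ.prod (gaussianReal 0 1)] = 1 + Var[V; μ] := by
  have h := variance_add_prod hV.neg (memLp_id_gaussianReal (μ := 0) (v := 1) 2)
  simp only [Pi.neg_apply, id, neg_add_eq_sub] at h
  rw [h, variance_neg, variance_id_gaussianReal, NNReal.coe_one, add_comm]

theorem covariance_snd_sub {R V : Ω → ℝ} [IsProbabilityMeasure μ] (hR : MemLp R 2 μ)
    (hV : MemLp V 2 μ) :
    cov[fun p : Ω × ℝ => R p.1, fun p => p.2 - V p.1; μ.prod (gaussianReal 0 1)] =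
      -cov[R, V; μ] := by
  have hid : MemLp (fun x : ℝ => x) 2 (gaussianReal 0 1) := memLp_id_gaussianReal 2
  have hfst : cov[fun p : Ω × ℝ => R p.1, fun p => V p.1; μ.prod (gaussianReal 0 1)] =
      cov[R, V; μ] := by
    have hmap := (measurePreserving_fst (μ := μ) (ν := gaussianReal 0 1)).map_eq
    rw [← covariance_map_fun (by rw [hmap]; exact hR.1) (by rw [hmap]; exact hV.1) (by fun_prop),
      hmap]
  rw [covariance_fun_sub_right (hR.comp_fst _) (hid.comp_snd _) (hV.comp_fst _),
    covariance_fst_snd_prod hR hid, hfst, zero_sub]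

theorem integral_mul_Phi_add_eq_setIntegral {R V : Ω → ℝ} [IsProbabilityMeasure μ]
    (hR : Integrable R μ) (hV : AEMeasurable V μ) (t : ℝ) :
    ∫ ω, R ω * Phi (t + V ω) ∂μ =
      ∫ p in {p : Ω × ℝ | p.2 - V p.1 ≤ t}, R p.1 ∂(μ.prod (gaussianReal 0 1)) := by
  have hset : NullMeasurableSet {p : Ω × ℝ | p.2 - V p.1 ≤ t} (μ.prod (gaussianReal 0 1)) :=
    (AEMeasurable.sub measurable_snd.aemeasurable hV.comp_fst).nullMeasurable measurableSet_Iic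
  rw [← integral_indicator₀ hset, integral_prod _ ((hR.comp_fst _).indicator₀ hset)]
  refine integral_congr_ae (.of_forall fun ω => ?_)
  have hsection : (fun x : ℝ =>
      {p : Ω × ℝ | p.2 - V p.1 ≤ t}.indicator (fun p => R p.1) (ω, x)) =
        (Set.Iic (t + V ω)).indicator fun _ => R ω := by
    ext x
    simp [Set.indicator_apply]
  simp only [hsection]
  rw [integral_indicator measurableSet_Iic, setIntegral_const, Phi_eq, smul_eq_mul, mul_comm]

theorem integral_Phi_add {V : Ω → ℝ} (hV : HasGaussianLaw V μ) (hV0 : μ[V] = 0) (t : ℝ) :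
    ∫ ω, Phi (t + V ω) ∂μ = Phi (t / √(1 + Var[V; μ])) := by
  have := hV.isProbabilityMeasure
  have hvar := variance_snd_sub hV.memLp_two
  have hgauss : HasGaussianLaw (fun p : Ω × ℝ => (V p.1, p.2 - V p.1)) _ :=
    hasGaussianLaw_prodMk_snd_sub (R := V) (hV.map_fun
      ((ContinuousLinearMap.id ℝ ℝ).prod (ContinuousLinearMap.id ℝ ℝ)))
  have h := integral_mul_Phi_add_eq_setIntegral (integrable_const (μ := μ) 1) hV.aemeasurable t
  simp only [one_mul, setIntegral_const, smul_eq_mul, mul_one] at h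
  rw [h, measureReal_le_eq_Phi hgauss.snd, hvar]
  · simpa [hV0] using integral_snd_sub hV.integrable
  · rw [hvar]
    linarith [variance_nonneg V μ]

theorem integral_mul_Phi_add {R V : Ω → ℝ} (hRV : HasGaussianLaw (fun ω => (R ω, V ω)) μ)
    (hR0 : μ[R] = 0) (hV0 : μ[V] = 0) (t : ℝ) :
    ∫ ω, R ω * Phi (t + V ω) ∂μ =
      cov[R, V; μ] / √(1 + Var[V; μ]) * gaussianPDFReal 0 1 (t / √(1 + Var[V; μ])) := by
  have := hRV.isProbabilityMeasure
  have hvar := variance_snd_sub hRV.snd.memLp_two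
  rw [integral_mul_Phi_add_eq_setIntegral hRV.fst.integrable hRV.snd.aemeasurable,
    setIntegral_le_of_hasGaussianLaw (hasGaussianLaw_prodMk_snd_sub hRV), hvar,
    covariance_snd_sub hRV.fst.memLp_two hRV.snd.memLp_two]
  · ring
  · simp [integral_fun_fst, hR0]
  · simpa [hV0] using integral_snd_sub hRV.snd.integrable
  · rw [hvar]
    linarith [variance_nonneg V μ]

end Probit

section Independence

variable {Ω 𝓧 𝓨 : Type*} [MeasurableSpace Ω] [MeasurableSpace 𝓧] [MeasurableSpace 𝓨]
  {μ : Measure Ω} [IsFiniteMeasure μ] {X : Ω → 𝓧} {Y : Ω → 𝓨} {G : 𝓧 → 𝓨 → ℝ}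

theorem integrable_comp_of_indepFun (hX : AEMeasurable X μ) (hY : AEMeasurable Y μ)
    (hXY : IndepFun X Y μ) (hG : Measurable fun p : 𝓧 × 𝓨 => G p.1 p.2) (hG0 : ∀ x y, 0 ≤ G x y)
    (hint : ∀ x, Integrable (fun ω => G x (Y ω)) μ) {C : ℝ} (hC : ∀ x, ∫ ω, G x (Y ω) ∂μ ≤ C) :
    Integrable (fun ω => G (X ω) (Y ω)) μ := by
  have hGx (x : 𝓧) : Measurable (G x) := hG.comp measurable_prodMk_left
  have hnorm (x : 𝓧) : ∫ y, ‖G x y‖ ∂(μ.map Y) = ∫ ω, G x (Y ω) ∂μ := by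
    rw [integral_map hY (hGx x).norm.aestronglyMeasurable]
    simp only [Real.norm_of_nonneg (hG0 _ _)]
  refine Integrable.comp_aemeasurable (f := fun ω => (X ω, Y ω)) (g := fun p => G p.1 p.2) ?_
    (hX.prodMk hY)
  rw [(indepFun_iff_map_prod_eq_prod_map_map hX hY).1 hXY,
    integrable_prod_iff hG.aestronglyMeasurable]
  refine ⟨.of_forall fun x => ?_, ?_⟩
  · exact (integrable_map_measure (hGx x).aestronglyMeasurable hY).2 (hint x)
  · refine .of_bound hG.norm.stronglyMeasurable.integral_prod_right.aestronglyMeasurable C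
      (.of_forall fun x => ?_)
    rw [hnorm, Real.norm_of_nonneg (integral_nonneg fun ω => hG0 _ _)]
    exact hC x

theorem setIntegral_comp_eq_zero_of_indepFun (hX : AEMeasurable X μ) (hY : AEMeasurable Y μ)
    (hXY : IndepFun X Y μ) (hG : Measurable fun p : 𝓧 × 𝓨 => G p.1 p.2)
    (hint : Integrable (fun ω => G (X ω) (Y ω)) μ) (hzero : ∀ x, ∫ ω, G x (Y ω) ∂μ = 0)
    {B : Set 𝓧} (hB : MeasurableSet B) : ∫ ω in X ⁻¹' B, G (X ω) (Y ω) ∂μ = 0 := by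
  have hinner (x : 𝓧) : ∫ y, G x y ∂(μ.map Y) = 0 := by
    have hGx : Measurable (G x) := hG.comp measurable_prodMk_left
    rw [integral_map hY hGx.aestronglyMeasurable, hzero]
  have hmap := (indepFun_iff_map_prod_eq_prod_map_map hX hY).1 hXY
  have hintprod : Integrable (fun p : 𝓧 × 𝓨 => G p.1 p.2) ((μ.map X).prod (μ.map Y)) := by
    rw [← hmap]
    exact (integrable_map_measure hG.aestronglyMeasurable (hX.prodMk hY)).2 hint
  have hset : X ⁻¹' B = (fun ω => (X ω, Y ω)) ⁻¹' B ×ˢ Set.univ := by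
    ext
    simp
  rw [hset, ← setIntegral_map (f := fun p : 𝓧 × 𝓨 => G p.1 p.2) (hB.prod .univ)
    hG.aestronglyMeasurable (hX.prodMk hY), hmap, setIntegral_prod _ hintprod.integrableOn]
  simp [hinner]

end Independence

section Tilt

variable {Ω 𝓧 : Type*} [MeasurableSpace Ω] [MeasurableSpace 𝓧] {μ : Measure Ω} {X : Ω → 𝓧}
  {R V : Ω → ℝ} {τ : 𝓧 → ℝ}

theorem integrable_Phi_add [IsFiniteMeasure μ] (hV : AEMeasurable V μ) (t : ℝ) :
    Integrable (fun ω => Phi (t + V ω)) μ :=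
  .of_bound (measurable_Phi.comp_aemeasurable (hV.const_add t)).aestronglyMeasurable 1
    (.of_forall fun _ => norm_Phi_le_one _)

theorem integrable_Phi_mul_WPhi (hX : AEMeasurable X μ) (hV : HasGaussianLaw V μ)
    (hV0 : μ[V] = 0) (hXV : IndepFun X V μ) (hτ : Measurable τ) :
    Integrable (fun ω => Phi (√(1 + Var[V; μ]) * τ (X ω) + V ω) * WPhi (τ (X ω))) μ := by
  have := hV.isProbabilityMeasure
  have hs : √(1 + Var[V; μ]) ≠ 0 := (Real.sqrt_pos.2 (by linarith [variance_nonneg V μ])).ne'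
  refine integrable_comp_of_indepFun (C := 1) (Y := V)
    (G := fun x v => Phi (√(1 + Var[V; μ]) * τ x + v) * WPhi (τ x)) hX hV.aemeasurable hXV
    ((measurable_Phi.comp (by fun_prop)).mul (measurable_WPhi.comp (by fun_prop)))
    (fun x v => mul_nonneg (Phi_nonneg _) (WPhi_nonneg _))
    (fun x => (integrable_Phi_add hV.aemeasurable _).mul_const _) fun x => ?_
  rw [integral_mul_const, integral_Phi_add hV hV0, mul_div_cancel_left₀ _ hs, Phi_mul_WPhi]
  exact gaussianPDFReal_zero_one_le_one _

theorem setIntegral_Phi_mul_sub_eq_zero (hX : AEMeasurable X μ)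
    (hRV : HasGaussianLaw (fun ω => (R ω, V ω)) μ) (hR0 : μ[R] = 0) (hV0 : μ[V] = 0)
    (hXRV : IndepFun X (fun ω => (R ω, V ω)) μ) (hτ : Measurable τ) {B : Set 𝓧}
    (hB : MeasurableSet B) :
    ∫ ω in X ⁻¹' B, Phi (√(1 + Var[V; μ]) * τ (X ω) + V ω) *
      (R ω - WPhi (τ (X ω)) * (cov[R, V; μ] / √(1 + Var[V; μ]))) ∂μ = 0 := by
  have := hRV.isProbabilityMeasure
  set s := √(1 + Var[V; μ]) with hs
  have hs0 : s ≠ 0 := (Real.sqrt_pos.2 (by linarith [variance_nonneg V μ])).ne'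
  have hRPhi (t : Ω → ℝ) (ht : AEMeasurable t μ) : Integrable (fun ω => R ω * Phi (t ω)) μ :=
    hRV.fst.integrable.mul_bdd (measurable_Phi.comp_aemeasurable ht).aestronglyMeasurable
      (.of_forall fun _ => norm_Phi_le_one _)
  refine setIntegral_comp_eq_zero_of_indepFun (Y := fun ω => (R ω, V ω))
    (G := fun x p => Phi (s * τ x + p.2) * (p.1 - WPhi (τ x) * (cov[R, V; μ] / s)))
    hX hRV.aemeasurable hXRV ?_ ?_ (fun x => ?_) hB
  · exact (measurable_Phi.comp (by fun_prop)).mul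
      (measurable_snd.fst.sub ((measurable_WPhi.comp (by fun_prop)).mul_const _))
  · have hXV : IndepFun X V μ := hXRV.comp measurable_id measurable_snd
    have hWPhi := integrable_Phi_mul_WPhi hX hRV.snd hV0 hXV hτ
    refine ((hRPhi (fun ω => s * τ (X ω) + V ω) (((hτ.comp_aemeasurable hX).const_mul s).add
      hRV.snd.aemeasurable)).sub (hWPhi.mul_const (cov[R, V; μ] / s))).congr
      (.of_forall fun ω => ?_)
    simp only [Pi.sub_apply]
    ring
  · simp only [mul_sub, mul_comm (Phi _) (R _)]
    rw [integral_sub (hRPhi _ (hRV.snd.aemeasurable.const_add _))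
      ((integrable_Phi_add hRV.snd.aemeasurable _).mul_const _), integral_mul_const,
      integral_Phi_add hRV.snd hV0, integral_mul_Phi_add hRV hR0 hV0, ← hs,
      mul_div_cancel_left₀ _ hs0, ← mul_assoc, Phi_mul_WPhi]
    ring

end Tilt

section NormalLaw

variable {ι : Type*} [Fintype ι]

theorem map_withDensity_comp {𝓧 𝓨 : Type*} [MeasurableSpace 𝓧] [MeasurableSpace 𝓨]
    {μ : Measure 𝓧} {T : 𝓧 → 𝓨} (hT : Measurable T) {g : 𝓨 → ℝ≥0∞} (hg : Measurable g) :
    (μ.withDensity (g ∘ T)).map T = (μ.map T).withDensity g := by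
  ext s hs
  rw [Measure.map_apply hT hs, withDensity_apply _ (hT hs), withDensity_apply _ hs,
    setLIntegral_map hs hg hT]
  rfl

theorem measurable_mulVec {κ : Type*} [Finite κ] (A : Matrix κ ι ℝ) :
    Measurable fun x : ι → ℝ => A *ᵥ x :=
  (continuous_const.matrix_mulVec continuous_id).measurable

theorem measurable_dotProduct (a : ι → ℝ) : Measurable fun x : ι → ℝ => a ⬝ᵥ x :=
  (continuous_const.dotProduct continuous_id).measurable

theorem inner_toLp_eq_dotProduct (a : ι → ℝ) (x : EuclideanSpace ℝ ι) :
    inner ℝ (WithLp.toLp 2 a) x = a ⬝ᵥ WithLp.ofLp x := by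
  simp [PiLp.inner_apply, dotProduct, mul_comm]

variable [DecidableEq ι]

theorem measurable_normalPDF (mu : ι → ℝ) (S : Matrix ι ι ℝ) : Measurable (normalPDF mu S) := by
  unfold normalPDF
  simp only [dotProduct, mulVec, Pi.sub_apply]
  fun_prop

theorem normalPDF_nonneg (mu : ι → ℝ) (S : Matrix ι ι ℝ) (y : ι → ℝ) : 0 ≤ normalPDF mu S y :=
  mul_nonneg (inv_nonneg.2 (Real.sqrt_nonneg _)) (Real.exp_nonneg _)

theorem normalPDF_zero_one (x : ι → ℝ) : normalPDF 0 1 x = ∏ i, gaussianPDFReal 0 1 (x i) := by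
  have hsqrt : √((2 * Real.pi) ^ Fintype.card ι) = √(2 * Real.pi) ^ Fintype.card ι := by
    rw [Real.sqrt_eq_iff_mul_self_eq (by positivity) (by positivity), ← mul_pow,
      Real.mul_self_sqrt (by positivity)]
  have hexp : -(x ⬝ᵥ x) / 2 = ∑ i, -x i ^ 2 / 2 := by
    rw [← Finset.sum_div, Finset.sum_neg_distrib]
    simp [dotProduct, sq]
  simp only [normalPDF, det_one, mul_one, inv_one, sub_zero, one_mulVec, hsqrt, hexp, Real.exp_sum,
    gaussianPDFReal_zero_one, Finset.prod_mul_distrib, Finset.prod_const, Finset.card_univ,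
    inv_pow]

theorem pi_gaussianReal_eq_withDensity_normalPDF :
    Measure.pi (fun _ : ι => gaussianReal 0 1) =
      volume.withDensity fun x => ENNReal.ofReal (normalPDF 0 1 x) := by
  refine Measure.pi_eq fun s hs => ?_
  have hint (i : ι) : Integrable (gaussianPDFReal 0 1) (volume.restrict (s i)) :=
    (integrable_gaussianPDFReal 0 1).restrict
  rw [withDensity_apply _ (.univ_pi hs), volume_pi, Measure.restrict_pi_pi]
  simp only [normalPDF_zero_one]
  rw [← ofReal_integral_eq_lintegral_ofReal (Integrable.fintype_prod hint)
      (.of_forall fun x => Finset.prod_nonneg fun i _ => gaussianPDFReal_nonneg _ _ _),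
    integral_fintype_prod_eq_prod (fun _ : ι => gaussianPDFReal 0 1),
    ENNReal.ofReal_prod_of_nonneg fun i _ => integral_nonneg fun x => gaussianPDFReal_nonneg _ _ _]
  exact Finset.prod_congr rfl fun i _ => (gaussianReal_apply_eq_integral 0 one_ne_zero (s i)).symm

theorem normalPDF_eq_abs_det_mul {A : Matrix ι ι ℝ} (hA : A.det ≠ 0) (b mu : ι → ℝ)
    (S : Matrix ι ι ℝ) (x : ι → ℝ) :
    normalPDF mu S x = |A.det| * normalPDF (b + A *ᵥ mu) (A * S * Aᵀ) (b + A *ᵥ x) := by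
  have hA' : IsUnit A.det := hA.isUnit
  have hquad : (A *ᵥ (x - mu)) ⬝ᵥ ((A * S * Aᵀ)⁻¹ *ᵥ (A *ᵥ (x - mu))) =
      (x - mu) ⬝ᵥ (S⁻¹ *ᵥ (x - mu)) := by
    rw [Matrix.mul_inv_rev, Matrix.mul_inv_rev, ← mulVec_mulVec, ← mulVec_mulVec,
      mulVec_mulVec _ A⁻¹ A, nonsing_inv_mul A hA', one_mulVec, dotProduct_mulVec,
      ← transpose_nonsing_inv, vecMul_transpose, mulVec_mulVec, nonsing_inv_mul A hA', one_mulVec]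
  have hdet : √((2 * Real.pi) ^ Fintype.card ι * (A * S * Aᵀ).det) =
      √((2 * Real.pi) ^ Fintype.card ι * S.det) * |A.det| := by
    rw [det_mul, det_mul, det_transpose, mul_right_comm, mul_comm (A.det * A.det), ← mul_assoc,
      Real.sqrt_mul' _ (mul_self_nonneg _), Real.sqrt_mul_self_eq_abs]
  rw [normalPDF, normalPDF, add_sub_add_left_eq_sub, ← mulVec_sub, hquad, hdet, mul_inv,
    ← mul_assoc, mul_left_comm, mul_inv_cancel₀ (abs_ne_zero.2 hA), mul_one]

theorem map_affine_withDensity_normalPDF {A : Matrix ι ι ℝ} (hA : A.det ≠ 0) (b mu : ι → ℝ)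
    (S : Matrix ι ι ℝ) :
    (volume.withDensity fun x => ENNReal.ofReal (normalPDF mu S x)).map (fun x => b + A *ᵥ x) =
      volume.withDensity fun y =>
        ENNReal.ofReal (normalPDF (b + A *ᵥ mu) (A * S * Aᵀ) y) := by
  have hdet : ENNReal.ofReal |A.det| ≠ 0 := by simpa using hA
  have hT : Measurable fun x : ι → ℝ => b + A *ᵥ x := (measurable_mulVec A).const_add b
  have hvol : (volume.map fun x : ι → ℝ => b + A *ᵥ x) =
      (ENNReal.ofReal |A.det|)⁻¹ • volume := by
    have hlin := Real.map_matrix_volume_pi_eq_smul_volume_pi hA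
    rw [abs_inv, ENNReal.ofReal_inv_of_pos (abs_pos.2 hA)] at hlin
    calc volume.map (fun x : ι → ℝ => b + A *ᵥ x)
        = (volume.map (toLin' A)).map (b + ·) :=
          (Measure.map_map (measurable_const_add b) (measurable_mulVec A)).symm
      _ = _ := by rw [hlin, Measure.map_smul, map_add_left_eq_self]
  have hpdf : (fun x => ENNReal.ofReal (normalPDF mu S x)) =
      (fun y => ENNReal.ofReal |A.det| *
        ENNReal.ofReal (normalPDF (b + A *ᵥ mu) (A * S * Aᵀ) y)) ∘ fun x => b + A *ᵥ x := by
    ext x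
    rw [normalPDF_eq_abs_det_mul hA b, ENNReal.ofReal_mul (abs_nonneg _)]
    rfl
  have hmeas := (measurable_normalPDF (b + A *ᵥ mu) (A * S * Aᵀ)).ennreal_ofReal
  rw [hpdf, map_withDensity_comp hT (hmeas.const_mul _), hvol, withDensity_smul_measure,
    ← withDensity_smul' _ _ (by simp [hdet])]
  congr with y
  simp [← mul_assoc, ENNReal.inv_mul_cancel hdet ENNReal.ofReal_ne_top]

theorem transpose_sqrt (S : Matrix ι ι ℝ) : (CFC.sqrt S)ᵀ = CFC.sqrt S := by
  simpa using (nonneg_iff_posSemidef.1 (CFC.sqrt_nonneg S)).1.eq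

/-- The centred normal law `N(0, S)`: Mathlib's `multivariateGaussian`, carried from the Euclidean
space to `ι → ℝ`, where the densities `normalPDF` live. -/
def centredNormal (S : Matrix ι ι ℝ) : Measure (ι → ℝ) :=
  (multivariateGaussian 0 S).map WithLp.ofLp

theorem centredNormal_eq_withDensity {S : Matrix ι ι ℝ} (hS : S.PosDef) :
    centredNormal S = volume.withDensity fun x => ENNReal.ofReal (normalPDF 0 S x) := by
  have hsqrt : CFC.sqrt S * 1 * (CFC.sqrt S)ᵀ = S := by
    rw [transpose_sqrt, mul_one, CFC.sqrt_mul_sqrt_self S hS.posSemidef.nonneg]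
  have hdet : (CFC.sqrt S).det ≠ 0 := by
    intro h
    have hdetS := congrArg det hsqrt
    rw [det_mul, det_mul, h, zero_mul, zero_mul] at hdetS
    exact hS.det_pos.ne hdetS
  have haffine := map_affine_withDensity_normalPDF hdet 0 0 1
  rw [hsqrt, mulVec_zero, zero_add, ← pi_gaussianReal_eq_withDensity_normalPDF] at haffine
  rw [← haffine, centredNormal, multivariateGaussian, ← map_pi_eq_stdGaussian,
    Measure.map_map (by fun_prop) (by fun_prop), Measure.map_map (by fun_prop) (by fun_prop)]
  congr 1

variable (S : Matrix ι ι ℝ)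

theorem hasGaussianLaw_id_centredNormal : HasGaussianLaw id (centredNormal S) := by
  refine ⟨?_⟩
  rw [Measure.map_id]
  exact isGaussian_map (μ := multivariateGaussian 0 S)
    (PiLp.continuousLinearEquiv 2 ℝ fun _ : ι => ℝ).toContinuousLinearMap

instance : IsProbabilityMeasure (centredNormal S) :=
  (hasGaussianLaw_id_centredNormal S).isProbabilityMeasure

theorem hasGaussianLaw_dotProduct_centredNormal (a : ι → ℝ) :
    HasGaussianLaw (fun w => a ⬝ᵥ w) (centredNormal S) :=
  (hasGaussianLaw_id_centredNormal S).map_fun (dotProductBilin ℝ ℝ a).toContinuousLinearMap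

theorem integral_dotProduct_centredNormal (a : ι → ℝ) :
    ∫ w, a ⬝ᵥ w ∂(centredNormal S) = 0 := by
  rw [centredNormal, integral_map (by fun_prop) (measurable_dotProduct a).aestronglyMeasurable]
  simp only [← inner_toLp_eq_dotProduct]
  exact ((innerSL ℝ (WithLp.toLp 2 a)).integral_comp_comm
    (IsGaussian.integrable_id (μ := multivariateGaussian 0 S))).trans (by simp)

variable {S}

theorem covariance_dotProduct_centredNormal (hS : S.PosSemidef) (a b : ι → ℝ) :
    cov[fun w => a ⬝ᵥ w, fun w => b ⬝ᵥ w; centredNormal S] = a ⬝ᵥ (S *ᵥ b) := by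
  have hmeas (c : ι → ℝ) : AEStronglyMeasurable (fun w => c ⬝ᵥ w) (centredNormal S) :=
    (measurable_dotProduct c).aestronglyMeasurable
  have h := covarianceBilin_multivariateGaussian (μ := 0) hS (WithLp.toLp 2 a) (WithLp.toLp 2 b)
  rw [covarianceBilin_apply_eq_cov IsGaussian.memLp_two_id] at h
  simp only [inner_toLp_eq_dotProduct] at h
  rw [centredNormal, covariance_map_fun (hmeas a) (hmeas b) (by fun_prop), h]

end NormalLaw

section SkewNormal

variable {ι : Type*} [Fintype ι]

theorem measurable_two_mul_Phi_dotProduct (υ : ι → ℝ) :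
    Measurable fun w : ι → ℝ => 2 * Phi (υ ⬝ᵥ w) :=
  (measurable_Phi.comp (measurable_dotProduct υ)).const_mul 2

variable [DecidableEq ι]

/-- The centred skew normal law `SN(0, S)` with density `2 φ(w; 0, S) Φ(υᵀ w)`. The skewness is
entered through `υ = S^{-1/2} lam`, the vector that the closed formulas are written in. -/
def skewNormal (S : Matrix ι ι ℝ) (υ : ι → ℝ) : Measure (ι → ℝ) :=
  (centredNormal S).withDensity fun w => ENNReal.ofReal (2 * Phi (υ ⬝ᵥ w))

instance (S : Matrix ι ι ℝ) (υ : ι → ℝ) : IsFiniteMeasure (skewNormal S υ) := by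
  refine isFiniteMeasure_withDensity_ofReal (Integrable.of_bound (C := 2)
    (measurable_two_mul_Phi_dotProduct υ).aestronglyMeasurable (.of_forall fun w => ?_)).2
  rw [Real.norm_of_nonneg (mul_nonneg zero_le_two (Phi_nonneg _))]
  linarith [Phi_le_one (υ ⬝ᵥ w)]

theorem dotProduct_sqrt_mulVec (S : Matrix ι ι ℝ) (a b : ι → ℝ) :
    a ⬝ᵥ (CFC.sqrt S *ᵥ b) = (CFC.sqrt S *ᵥ a) ⬝ᵥ b := by
  rw [dotProduct_mulVec, ← mulVec_transpose, transpose_sqrt]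

theorem map_smul_centredNormal {S : Matrix ι ι ℝ} (hS : S.PosDef) (mu : ι → ℝ) {u : ℝ}
    (hu : 0 < u) :
    (centredNormal S).map (fun w => mu + (√u)⁻¹ • w) =
      volume.withDensity fun y => ENNReal.ofReal (normalPDF mu (u⁻¹ • S) y) := by
  have hdet : ((√u)⁻¹ • (1 : Matrix ι ι ℝ)).det ≠ 0 := by
    simp [(Real.sqrt_pos.2 hu).ne']
  have haffine := map_affine_withDensity_normalPDF hdet mu 0 S
  have hcov : (√u)⁻¹ • (1 : Matrix ι ι ℝ) * S * ((√u)⁻¹ • (1 : Matrix ι ι ℝ))ᵀ = u⁻¹ • S := by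
    rw [transpose_smul, transpose_one, smul_mul_assoc, one_mul, mul_smul_comm, mul_one, smul_smul,
      ← mul_inv, Real.mul_self_sqrt hu.le]
  rw [← centredNormal_eq_withDensity hS, hcov, mulVec_zero, add_zero] at haffine
  simpa only [smul_mulVec, one_mulVec] using haffine

theorem map_smul_skewNormal {S : Matrix ι ι ℝ} (hS : S.PosDef) (mu lam : ι → ℝ) {u : ℝ}
    (hu : 0 < u) :
    (skewNormal S (CFC.sqrt S⁻¹ *ᵥ lam)).map (fun w => mu + (√u)⁻¹ • w) =
      volume.withDensity fun y => ENNReal.ofReal (condPDF mu S lam u y) := by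
  have hskew : (fun w => ENNReal.ofReal (2 * Phi ((CFC.sqrt S⁻¹ *ᵥ lam) ⬝ᵥ w))) =
      (fun y => ENNReal.ofReal (2 * Phi (√u * (lam ⬝ᵥ (CFC.sqrt S⁻¹ *ᵥ (y - mu)))))) ∘
        fun w => mu + (√u)⁻¹ • w := by
    ext w
    simp only [Function.comp_apply, add_sub_cancel_left, dotProduct_smul, smul_eq_mul,
      mul_inv_cancel_left₀ (Real.sqrt_pos.2 hu).ne', dotProduct_sqrt_mulVec]
  have hmeas : Measurable fun y : ι → ℝ =>
      ENNReal.ofReal (2 * Phi (√u * (lam ⬝ᵥ (CFC.sqrt S⁻¹ *ᵥ (y - mu))))) := by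
    refine ((measurable_Phi.comp ?_).const_mul 2).ennreal_ofReal
    simp only [dotProduct, mulVec, Pi.sub_apply]
    fun_prop
  rw [skewNormal, hskew, map_withDensity_comp (by fun_prop) hmeas, map_smul_centredNormal hS mu hu,
    ← withDensity_mul _ (measurable_normalPDF _ _).ennreal_ofReal hmeas]
  congr with y
  rw [Pi.mul_apply, ← ENNReal.ofReal_mul (normalPDF_nonneg _ _ _), condPDF]
  congr 1
  ring

theorem prod_withDensity_eq_map_prod {𝓧 𝓨 𝓦 : Type*} [MeasurableSpace 𝓧] [MeasurableSpace 𝓨]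
    [MeasurableSpace 𝓦] {μ : Measure 𝓧} {ν : Measure 𝓨} {ρ : Measure 𝓦} [SFinite ν] [SFinite ρ]
    {f : 𝓧 × 𝓨 → ℝ≥0∞} (hf : Measurable f) {T : 𝓧 → 𝓦 → 𝓨}
    (hT : Measurable fun p : 𝓧 × 𝓦 => T p.1 p.2)
    (hslice : ∀ᵐ x ∂μ, ν.withDensity (fun y => f (x, y)) = ρ.map (T x)) :
    (μ.prod ν).withDensity f = (μ.prod ρ).map fun p => (p.1, T p.1 p.2) := by
  have hTm : Measurable fun p : 𝓧 × 𝓦 => (p.1, T p.1 p.2) := measurable_fst.prodMk hT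
  ext s hs
  rw [Measure.map_apply hTm hs, Measure.prod_apply (hTm hs), withDensity_apply _ hs,
    ← lintegral_indicator hs, lintegral_prod _ (hf.indicator hs).aemeasurable]
  refine lintegral_congr_ae (hslice.mono fun x hx => ?_)
  have hsx : MeasurableSet (Prod.mk x ⁻¹' s) := measurable_prodMk_left hs
  have hTx : Measurable (T x) := hT.comp measurable_prodMk_left
  calc ∫⁻ y, s.indicator f (x, y) ∂ν
      = ∫⁻ y in Prod.mk x ⁻¹' s, f (x, y) ∂ν := (lintegral_indicator hsx _)
    _ = ρ (T x ⁻¹' (Prod.mk x ⁻¹' s)) := by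
      rw [← withDensity_apply _ hsx, hx, Measure.map_apply hTx hsx]

theorem IsSMSN.map_joint_eq_map_prod {Ω : Type*} [MeasurableSpace Ω] {P : Measure Ω}
    {Y : Ω → ι → ℝ} {U : Ω → ℝ} {mu : ι → ℝ} {S : Matrix ι ι ℝ} {lam : ι → ℝ} {H : Measure ℝ}
    (h : IsSMSN P Y U mu S lam H) (hS : S.PosDef) (hH : ∀ᵐ u ∂H, 0 < u) :
    P.map (fun ω => (U ω, Y ω)) =
      (H.prod (skewNormal S (CFC.sqrt S⁻¹ *ᵥ lam))).map
        fun p => (p.1, mu + (√p.1)⁻¹ • p.2) := by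
  rw [h.map_joint]
  exact prod_withDensity_eq_map_prod (T := fun u w => mu + (√u)⁻¹ • w)
    (measurable_condPDF mu S lam).ennreal_ofReal (by fun_prop)
    (hH.mono fun u hu => (map_smul_skewNormal hS mu lam hu).symm)

end SkewNormal

section Partition

variable {ι κ : Type*} [Fintype ι] [DecidableEq ι]

/-- `μ₂.₁(y) = μ₂ + S₂₁ S₁₁⁻¹ (y - μ₁)`, the regression of the second block of a vector with
location `mu` and dispersion `S` on its first block. -/
def regression (mu : ι ⊕ κ → ℝ) (S : Matrix (ι ⊕ κ) (ι ⊕ κ) ℝ) (y : ι → ℝ) : κ → ℝ :=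
  mu ∘ Sum.inr + S.toBlocks₂₁ *ᵥ (S.toBlocks₁₁⁻¹ *ᵥ (y - mu ∘ Sum.inl))

/-- `S₂₂.₁ = S₂₂ - S₂₁ S₁₁⁻¹ S₁₂`, the dispersion of the regression residual. -/
def schurCompl (S : Matrix (ι ⊕ κ) (ι ⊕ κ) ℝ) : Matrix κ κ ℝ :=
  S.toBlocks₂₂ - S.toBlocks₂₁ * S.toBlocks₁₁⁻¹ * S.toBlocks₁₂

/-- The matrix `(-S₂₁ S₁₁⁻¹  1)`, which maps a centred vector to its regression residual. -/
def residualMatrix [DecidableEq κ] (S : Matrix (ι ⊕ κ) (ι ⊕ κ) ℝ) : Matrix κ (ι ⊕ κ) ℝ :=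
  fromCols (-(S.toBlocks₂₁ * S.toBlocks₁₁⁻¹)) 1

variable [Fintype κ]

/-- `√(1 + υ₂ᵀ S₂₂.₁ υ₂)`, the root of one plus the variance of `υ₂ᵀ R` for a regression residual
`R`; it normalises the marginal skewness and the skewness correction of the predictor. -/
def residualScale (S : Matrix (ι ⊕ κ) (ι ⊕ κ) ℝ) (υ : ι ⊕ κ → ℝ) : ℝ :=
  √(1 + (υ ∘ Sum.inr) ⬝ᵥ (schurCompl S *ᵥ (υ ∘ Sum.inr)))

/-- `υ̃ = (υ₁ + S₁₁⁻¹ S₁₂ υ₂) / √(1 + υ₂ᵀ S₂₂.₁ υ₂)`, the skewness of the first block. -/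
def marginalSkewness (S : Matrix (ι ⊕ κ) (ι ⊕ κ) ℝ) (υ : ι ⊕ κ → ℝ) : ι → ℝ :=
  (residualScale S υ)⁻¹ •
    (υ ∘ Sum.inl + S.toBlocks₁₁⁻¹ *ᵥ (S.toBlocks₁₂ *ᵥ (υ ∘ Sum.inr)))

variable [DecidableEq κ] {S : Matrix (ι ⊕ κ) (ι ⊕ κ) ℝ}

theorem residualMatrix_mulVec (S : Matrix (ι ⊕ κ) (ι ⊕ κ) ℝ) (w : ι ⊕ κ → ℝ) :
    residualMatrix S *ᵥ w =
      w ∘ Sum.inr - S.toBlocks₂₁ *ᵥ (S.toBlocks₁₁⁻¹ *ᵥ (w ∘ Sum.inl)) := by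
  rw [residualMatrix, fromCols_mulVec, one_mulVec, neg_mulVec, mulVec_mulVec, neg_add_eq_sub]

theorem sub_regression_eq_residualMatrix_mulVec (mu v : ι ⊕ κ → ℝ)
    (S : Matrix (ι ⊕ κ) (ι ⊕ κ) ℝ) :
    v ∘ Sum.inr - regression mu S (v ∘ Sum.inl) = residualMatrix S *ᵥ (v - mu) := by
  rw [residualMatrix_mulVec, regression, ← sub_sub]
  rfl

theorem residualMatrix_mul (hS : S.PosDef) :
    residualMatrix S * S = fromCols 0 (schurCompl S) := by
  have hdet : IsUnit S.toBlocks₁₁.det := (hS.submatrix Sum.inl_injective).det_pos.ne'.isUnit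
  nth_rw 2 [← fromBlocks_toBlocks S]
  rw [residualMatrix, fromCols_mul_fromBlocks, Matrix.one_mul, Matrix.one_mul, Matrix.neg_mul,
    Matrix.neg_mul, nonsing_inv_mul_cancel_right _ _ hdet, neg_add_cancel, neg_add_eq_sub,
    schurCompl]

theorem covariance_residual_dotProduct (hS : S.PosDef) (b : κ → ℝ) (a : ι ⊕ κ → ℝ) :
    cov[fun w => b ⬝ᵥ (residualMatrix S *ᵥ w), fun w => a ⬝ᵥ w; centredNormal S] =
      b ⬝ᵥ (schurCompl S *ᵥ (a ∘ Sum.inr)) := by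
  simp only [dotProduct_mulVec b]
  rw [covariance_dotProduct_centredNormal hS.posSemidef, ← dotProduct_mulVec, mulVec_mulVec,
    residualMatrix_mul hS, fromCols_mulVec, zero_mulVec, zero_add, dotProduct_mulVec]

theorem covariance_residual (hS : S.PosDef) (b c : κ → ℝ) :
    cov[fun w => b ⬝ᵥ (residualMatrix S *ᵥ w), fun w => c ⬝ᵥ (residualMatrix S *ᵥ w);
      centredNormal S] = b ⬝ᵥ (schurCompl S *ᵥ c) := by
  simp only [dotProduct_mulVec c]
  rw [covariance_residual_dotProduct hS]
  congr 2
  simp [residualMatrix]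

theorem variance_residual (hS : S.PosDef) (b : κ → ℝ) :
    Var[fun w => b ⬝ᵥ (residualMatrix S *ᵥ w); centredNormal S] = b ⬝ᵥ (schurCompl S *ᵥ b) := by
  rw [← covariance_residual hS, covariance_self]
  exact ((measurable_dotProduct b).comp (measurable_mulVec _)).aemeasurable

theorem integral_residual (S : Matrix (ι ⊕ κ) (ι ⊕ κ) ℝ) (b : κ → ℝ) :
    ∫ w, b ⬝ᵥ (residualMatrix S *ᵥ w) ∂(centredNormal S) = 0 := by
  simp only [dotProduct_mulVec b]
  exact integral_dotProduct_centredNormal S _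

theorem indepFun_inl_residual (hS : S.PosDef) :
    IndepFun (fun w : ι ⊕ κ → ℝ => w ∘ Sum.inl) (fun w => residualMatrix S *ᵥ w)
      (centredNormal S) := by
  have hgauss : HasGaussianLaw (fun w : ι ⊕ κ → ℝ => (w ∘ Sum.inl, residualMatrix S *ᵥ w))
      (centredNormal S) :=
    (hasGaussianLaw_id_centredNormal S).map_fun
      ((LinearMap.funLeft ℝ ℝ Sum.inl).prod (residualMatrix S).mulVecLin).toContinuousLinearMap
  refine hgauss.indepFun_of_covariance_eval fun i j => ?_
  have hzero : (Pi.single (Sum.inl i) 1 : ι ⊕ κ → ℝ) ∘ Sum.inr = 0 := by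
    ext
    simp
  have hcov := covariance_residual_dotProduct hS (Pi.single j 1) (Pi.single (Sum.inl i) 1)
  rw [hzero, mulVec_zero, dotProduct_zero] at hcov
  rw [covariance_comm]
  simpa only [single_one_dotProduct, Function.comp_apply] using hcov

theorem residualScale_pos {κ : Type*} [Fintype κ] {S : Matrix (ι ⊕ κ) (ι ⊕ κ) ℝ} (hS : S.PosDef)
    (υ : ι ⊕ κ → ℝ) : 0 < residualScale S υ := by
  classical
  rw [residualScale, ← variance_residual hS]
  exact Real.sqrt_pos.2 (add_pos_of_pos_of_nonneg one_pos (variance_nonneg _ _))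

theorem dotProduct_eq_marginal_add_residual (hS : S.PosDef) (υ w : ι ⊕ κ → ℝ) :
    υ ⬝ᵥ w = residualScale S υ * (marginalSkewness S υ ⬝ᵥ (w ∘ Sum.inl)) +
      (υ ∘ Sum.inr) ⬝ᵥ (residualMatrix S *ᵥ w) := by
  have h11 : (S.toBlocks₁₁)ᵀ = S.toBlocks₁₁ := (hS.submatrix Sum.inl_injective).isHermitian
  have h21 : (S.toBlocks₂₁)ᵀ = S.toBlocks₁₂ := congrArg toBlocks₁₂ hS.isHermitian
  have hadj : (S.toBlocks₁₁⁻¹ *ᵥ (S.toBlocks₁₂ *ᵥ (υ ∘ Sum.inr))) ⬝ᵥ (w ∘ Sum.inl) =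
      (υ ∘ Sum.inr) ⬝ᵥ (S.toBlocks₂₁ *ᵥ (S.toBlocks₁₁⁻¹ *ᵥ (w ∘ Sum.inl))) := by
    rw [dotProduct_mulVec (υ ∘ Sum.inr), ← mulVec_transpose, h21,
      dotProduct_mulVec (S.toBlocks₁₂ *ᵥ _), ← mulVec_transpose, transpose_nonsing_inv, h11]
  have hsplit : υ ⬝ᵥ w =
      (υ ∘ Sum.inl) ⬝ᵥ (w ∘ Sum.inl) + (υ ∘ Sum.inr) ⬝ᵥ (w ∘ Sum.inr) :=
    Fintype.sum_sum_type _
  rw [marginalSkewness, smul_dotProduct, smul_eq_mul,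
    mul_inv_cancel_left₀ (residualScale_pos hS υ).ne', add_dotProduct, hadj,
    residualMatrix_mulVec, dotProduct_sub, hsplit]
  ring

end Partition

section SkewNormalIntegral

variable {ι : Type*} [Fintype ι] [DecidableEq ι] {S : Matrix ι ι ℝ} {υ : ι → ℝ} {f : (ι → ℝ) → ℝ}

theorem integrable_skewNormal_iff :
    Integrable f (skewNormal S υ) ↔
      Integrable (fun w => Phi (υ ⬝ᵥ w) * f w) (centredNormal S) := by
  rw [skewNormal, integrable_withDensity_iff_integrable_smul'
    (measurable_two_mul_Phi_dotProduct υ).ennreal_ofReal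
    (.of_forall fun _ => ENNReal.ofReal_lt_top)]
  simp only [ENNReal.toReal_ofReal (mul_nonneg zero_le_two (Phi_nonneg _)), smul_eq_mul, mul_assoc]
  exact integrable_const_mul_iff two_ne_zero.isUnit _

theorem setIntegral_skewNormal (f : (ι → ℝ) → ℝ) {B : Set (ι → ℝ)} (hB : MeasurableSet B) :
    ∫ w in B, f w ∂(skewNormal S υ) = 2 * ∫ w in B, Phi (υ ⬝ᵥ w) * f w ∂(centredNormal S) := by
  rw [skewNormal, setIntegral_withDensity_eq_setIntegral_toReal_smul
    (measurable_two_mul_Phi_dotProduct υ).ennreal_ofReal (.of_forall fun _ => ENNReal.ofReal_lt_top)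
    _ hB, ← integral_const_mul]
  simp only [ENNReal.toReal_ofReal (mul_nonneg zero_le_two (Phi_nonneg _)), smul_eq_mul, mul_assoc]

theorem integrable_dotProduct_skewNormal (S : Matrix ι ι ℝ) (υ a : ι → ℝ) :
    Integrable (fun w => a ⬝ᵥ w) (skewNormal S υ) :=
  integrable_skewNormal_iff.2 <| (hasGaussianLaw_dotProduct_centredNormal S a).integrable.bdd_mul
    (measurable_Phi.comp (measurable_dotProduct υ)).aestronglyMeasurable
    (.of_forall fun _ => norm_Phi_le_one _)

end SkewNormalIntegral

section SkewNormalResidual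

theorem measurable_comp_inl {ι κ : Type*} : Measurable fun w : ι ⊕ κ → ℝ => w ∘ Sum.inl :=
  measurable_pi_lambda _ fun i => measurable_pi_apply (Sum.inl i)

variable {ι κ : Type*} [Fintype ι] [DecidableEq ι] [Fintype κ] [DecidableEq κ]
  {S : Matrix (ι ⊕ κ) (ι ⊕ κ) ℝ}

theorem sqrt_one_add_variance_residual (hS : S.PosDef) (υ : ι ⊕ κ → ℝ) :
    √(1 + Var[fun w => (υ ∘ Sum.inr) ⬝ᵥ (residualMatrix S *ᵥ w); centredNormal S]) =
      residualScale S υ := by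
  rw [variance_residual hS, residualScale]

theorem hasGaussianLaw_residual (S : Matrix (ι ⊕ κ) (ι ⊕ κ) ℝ) (b c : κ → ℝ) :
    HasGaussianLaw (fun w => (b ⬝ᵥ (residualMatrix S *ᵥ w), c ⬝ᵥ (residualMatrix S *ᵥ w)))
      (centredNormal S) :=
  (hasGaussianLaw_id_centredNormal S).map_fun
    (((dotProductBilin ℝ ℝ b).prod (dotProductBilin ℝ ℝ c)) ∘ₗ
      (residualMatrix S).mulVecLin).toContinuousLinearMap

theorem integrable_WPhi_marginalSkewness (hS : S.PosDef) (υ : ι ⊕ κ → ℝ) :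
    Integrable (fun w => WPhi (marginalSkewness S υ ⬝ᵥ (w ∘ Sum.inl))) (skewNormal S υ) := by
  have hindep : IndepFun (fun w : ι ⊕ κ → ℝ => w ∘ Sum.inl)
      (fun w => (υ ∘ Sum.inr) ⬝ᵥ (residualMatrix S *ᵥ w)) (centredNormal S) :=
    (indepFun_inl_residual hS).comp measurable_id (measurable_dotProduct _)
  have hint := integrable_Phi_mul_WPhi measurable_comp_inl.aemeasurable
    (hasGaussianLaw_residual S (υ ∘ Sum.inr) (υ ∘ Sum.inr)).fst (integral_residual S _) hindep
    (measurable_dotProduct (marginalSkewness S υ))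
  rw [sqrt_one_add_variance_residual hS] at hint
  simpa only [integrable_skewNormal_iff, dotProduct_eq_marginal_add_residual hS υ] using hint

theorem setIntegral_residual_sub_WPhi_eq_zero (hS : S.PosDef) (υ : ι ⊕ κ → ℝ) (j : κ)
    {B : Set (ι → ℝ)} (hB : MeasurableSet B) :
    ∫ w in (fun w => w ∘ Sum.inl) ⁻¹' B, ((residualMatrix S *ᵥ w) j -
      WPhi (marginalSkewness S υ ⬝ᵥ (w ∘ Sum.inl)) *
        ((schurCompl S *ᵥ (υ ∘ Sum.inr)) j / residualScale S υ)) ∂(skewNormal S υ) = 0 := by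
  have hindep : IndepFun (fun w : ι ⊕ κ → ℝ => w ∘ Sum.inl)
      (fun w => (Pi.single j 1 ⬝ᵥ (residualMatrix S *ᵥ w),
        (υ ∘ Sum.inr) ⬝ᵥ (residualMatrix S *ᵥ w))) (centredNormal S) :=
    (indepFun_inl_residual hS).comp measurable_id
      ((measurable_dotProduct _).prodMk (measurable_dotProduct _))
  have hzero := setIntegral_Phi_mul_sub_eq_zero measurable_comp_inl.aemeasurable
    (hasGaussianLaw_residual S (Pi.single j 1) (υ ∘ Sum.inr)) (integral_residual S _)
    (integral_residual S _) hindep (measurable_dotProduct (marginalSkewness S υ)) hB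
  rw [sqrt_one_add_variance_residual hS, covariance_residual hS] at hzero
  simp only [single_one_dotProduct, ← dotProduct_eq_marginal_add_residual hS υ] at hzero
  rw [setIntegral_skewNormal _ (measurable_comp_inl hB)]
  exact mul_eq_zero_of_right 2 hzero

end SkewNormalResidual

section Pythagoras

variable {Ω : Type*} {m mΩ : MeasurableSpace Ω} {P : Measure Ω} [IsFiniteMeasure P]

theorem integral_sq_eq_integral_sq_sub_condExp_add (hm : m ≤ mΩ) {X : Ω → ℝ}
    (hX : MemLp X 2 P) :
    ∫ ω, X ω ^ 2 ∂P = ∫ ω, (X ω - P[X | m] ω) ^ 2 ∂P + ∫ ω, P[X | m] ω ^ 2 ∂P := by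
  have hcondVar : ∫ ω, Var[X; P | m] ω ∂P = ∫ ω, (P[X ^ 2 | m] - P[X | m] ^ 2 : Ω → ℝ) ω ∂P :=
    integral_congr_ae (condVar_ae_eq_condExp_sq_sub_sq_condExp hm hX)
  have hsq : Integrable (P[X | m] ^ 2) P := (hX.condExp one_le_two).integrable_sq
  rw [condVar, integral_condExp hm, integral_sub' integrable_condExp hsq,
    integral_condExp hm] at hcondVar
  exact sub_eq_iff_eq_add.1 hcondVar.symm

theorem lintegral_sq_eq_lintegral_sq_sub_condExp_add (hm : m ≤ mΩ) {X : Ω → ℝ}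
    (hX : MemLp X 2 P) :
    ∫⁻ ω, ENNReal.ofReal (X ω ^ 2) ∂P = ∫⁻ ω, ENNReal.ofReal ((X ω - P[X | m] ω) ^ 2) ∂P +
      ∫⁻ ω, ENNReal.ofReal (P[X | m] ω ^ 2) ∂P := by
  have hlintegral {Z : Ω → ℝ} (hZ : MemLp Z 2 P) :
      ∫⁻ ω, ENNReal.ofReal (Z ω ^ 2) ∂P = ENNReal.ofReal (∫ ω, Z ω ^ 2 ∂P) :=
    (ofReal_integral_eq_lintegral_ofReal hZ.integrable_sq (.of_forall fun _ => sq_nonneg _)).symm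
  have hcond : MemLp P[X | m] 2 P := hX.condExp one_le_two
  rw [hlintegral hX, hlintegral hcond, hlintegral (Z := fun ω => X ω - P[X | m] ω) (hX.sub hcond),
    ← ENNReal.ofReal_add (by positivity) (by positivity),
    integral_sq_eq_integral_sq_sub_condExp_add hm hX]

theorem lintegral_sq_sub_eq_add (hm : m ≤ mΩ) {V f g : Ω → ℝ} (hV : Integrable V P)
    (hf : P[V | m] =ᵐ[P] f) (hg : StronglyMeasurable[m] g)
    (hVg : MemLp (fun ω => V ω - g ω) 2 P) :
    ∫⁻ ω, ENNReal.ofReal ((V ω - g ω) ^ 2) ∂P = ∫⁻ ω, ENNReal.ofReal ((V ω - f ω) ^ 2) ∂P +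
      ∫⁻ ω, ENNReal.ofReal ((f ω - g ω) ^ 2) ∂P := by
  have hgi : Integrable g P := by
    simpa only [sub_sub_cancel] using hV.sub' (hVg.integrable one_le_two)
  have hcond : P[fun ω => V ω - g ω | m] =ᵐ[P] fun ω => f ω - g ω := by
    refine (condExp_sub hV hgi m).trans ?_
    rw [condExp_of_stronglyMeasurable hm hg hgi]
    exact hf.sub .rfl
  rw [lintegral_sq_eq_lintegral_sq_sub_condExp_add hm hVg]
  congr 1 <;> refine lintegral_congr_ae (hcond.mono fun ω hω => ?_)
  · simp only [hω, sub_sub_sub_cancel_right]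
  · simp only [hω]

end Pythagoras

section MeanSquaredError

variable {Ω : Type*} [MeasurableSpace Ω] {P : Measure Ω} {r : ℕ} {V W : Ω → Fin r → ℝ}

theorem mse_eq_sum (h : ∀ j, AEMeasurable (fun ω => V ω j - W ω j) P) :
    mse P V W = ∑ j, ∫⁻ ω, ENNReal.ofReal ((V ω j - W ω j) ^ 2) ∂P := by
  rw [mse, ← lintegral_finsetSum' _ fun j _ => ((h j).pow_const 2).ennreal_ofReal]
  simp only [ENNReal.ofReal_sum_of_nonneg fun _ _ => sq_nonneg _]

theorem memLp_two_of_mse_ne_top (h : ∀ j, AEMeasurable (fun ω => V ω j - W ω j) P)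
    (hfin : mse P V W ≠ ∞) (j : Fin r) : MemLp (fun ω => V ω j - W ω j) 2 P := by
  rw [mse_eq_sum h] at hfin
  rw [memLp_two_iff_integrable_sq (h j).aestronglyMeasurable]
  refine ⟨((h j).pow_const 2).aestronglyMeasurable, ?_⟩
  rw [hasFiniteIntegral_iff_ofReal (.of_forall fun _ => sq_nonneg _)]
  exact ENNReal.lt_top_of_sum_ne_top hfin (Finset.mem_univ j)

theorem ae_eq_of_mse_eq_zero (h : ∀ j, AEMeasurable (fun ω => V ω j - W ω j) P)
    (hzero : mse P V W = 0) : V =ᵐ[P] W := by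
  rw [mse_eq_sum h, Finset.sum_eq_zero_iff] at hzero
  have hcoord (j : Fin r) : ∀ᵐ ω ∂P, V ω j = W ω j := by
    have hsq := (lintegral_eq_zero_iff' ((h j).pow_const 2).ennreal_ofReal).1
      (hzero j (Finset.mem_univ j))
    filter_upwards [hsq] with ω hω
    exact sub_eq_zero.1 (pow_eq_zero_iff two_ne_zero |>.1
      (le_antisymm (ENNReal.ofReal_eq_zero.1 hω) (sq_nonneg _)))
  exact (ae_all_iff.2 hcoord).mono fun ω hω => funext hω

variable {𝓣 : Type*} [m𝓣 : MeasurableSpace 𝓣] {T : Ω → 𝓣} {f : 𝓣 → Fin r → ℝ}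

theorem mse_eq_add_of_condExp [IsFiniteMeasure P] (hT : Measurable T) (hf : Measurable f)
    (hV : ∀ j, Integrable (fun ω => V ω j) P)
    (hc : ∀ j, P[fun ω => V ω j | m𝓣.comap T] =ᵐ[P] fun ω => f (T ω) j)
    {g : 𝓣 → Fin r → ℝ} (hg : Measurable g) (hfin : mse P V (fun ω => g (T ω)) ≠ ∞) :
    mse P V (fun ω => g (T ω)) =
      mse P V (fun ω => f (T ω)) + mse P (fun ω => f (T ω)) fun ω => g (T ω) := by
  have hsub {h : 𝓣 → Fin r → ℝ} (hh : Measurable h) (j : Fin r) :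
      AEMeasurable (fun ω => V ω j - h (T ω) j) P :=
    (hV j).aemeasurable.sub (by fun_prop)
  rw [mse_eq_sum (hsub hg), mse_eq_sum (hsub hf), mse_eq_sum (fun j => by fun_prop),
    ← Finset.sum_add_distrib]
  exact Finset.sum_congr rfl fun j _ => lintegral_sq_sub_eq_add hT.comap_le (hV j) (hc j)
    (((measurable_pi_apply j).comp hg).comp (comap_measurable T)).stronglyMeasurable
    (memLp_two_of_mse_ne_top (hsub hg) hfin j)

theorem isMinMSEPredictor_of_condExp [IsFiniteMeasure P] (hT : Measurable T) (hf : Measurable f)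
    (hV : ∀ j, Integrable (fun ω => V ω j) P)
    (hc : ∀ j, P[fun ω => V ω j | m𝓣.comap T] =ᵐ[P] fun ω => f (T ω) j) :
    IsMinMSEPredictor P V T f := by
  have hle (g : 𝓣 → Fin r → ℝ) (hg : Measurable g) :
      mse P V (fun ω => f (T ω)) ≤ mse P V (fun ω => g (T ω)) := by
    by_cases hfin : mse P V (fun ω => g (T ω)) = ∞
    · exact hfin ▸ le_top
    · exact mse_eq_add_of_condExp hT hf hV hc hg hfin ▸ le_self_add
  refine ⟨hf, hle, fun g hg hfin hge => ?_⟩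
  have hzero : mse P (fun ω => f (T ω)) (fun ω => g (T ω)) = 0 := by
    have hfin' := ((hle g hg).trans_lt hfin.lt_top).ne
    rw [mse_eq_add_of_condExp hT hf hV hc hg hfin] at hge
    exact nonpos_iff_eq_zero.1 (ENNReal.le_of_add_le_add_left hfin' (by rwa [add_zero]))
  exact (ae_eq_of_mse_eq_zero (fun j => by fun_prop) hzero).symm

end MeanSquaredError

section ConditionalExpectation

variable {Ω 𝓣 : Type*} [MeasurableSpace Ω] [m𝓣 : MeasurableSpace 𝓣] {P : Measure Ω}
  [IsFiniteMeasure P] {T : Ω → 𝓣}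

theorem condExp_ae_eq_of_setIntegral_sub_eq_zero (hT : Measurable T) {V W : Ω → ℝ}
    (hV : Integrable V P) (hW : Integrable W P)
    (h : ∀ B, MeasurableSet B → ∫ ω in T ⁻¹' B, (V ω - W ω) ∂P = 0) :
    P[V | m𝓣.comap T] =ᵐ[P] P[W | m𝓣.comap T] := by
  refine ae_eq_condExp_of_forall_setIntegral_eq hT.comap_le hW
    (fun s _ _ => integrable_condExp.integrableOn) ?_
    stronglyMeasurable_condExp.aestronglyMeasurable
  rintro _ ⟨B, hB, rfl⟩ _
  rw [setIntegral_condExp hT.comap_le hV ⟨B, hB, rfl⟩]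
  exact sub_eq_zero.1 ((integral_sub hV.integrableOn hW.integrableOn).symm.trans (h B hB))

theorem condExp_prodMk_of_indepFun {𝓨 𝓞 𝓥 : Type*} [m𝓨 : MeasurableSpace 𝓨]
    [m𝓞 : MeasurableSpace 𝓞] [MeasurableSpace 𝓥] {Y : Ω → 𝓨} {W : Ω → 𝓥} {O : Ω → 𝓞}
    (hY : Measurable Y) (hW : Measurable W) (hO : Measurable O)
    (hind : IndepFun (fun ω => (Y ω, W ω)) O P) {v : 𝓥 → ℝ} (hv : Measurable v)
    (hV : Integrable (fun ω => v (W ω)) P) {f : 𝓨 → ℝ} (hf : Measurable f)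
    (hc : P[fun ω => v (W ω) | m𝓨.comap Y] =ᵐ[P] fun ω => f (Y ω)) :
    P[fun ω => v (W ω) | (m𝓨.prod m𝓞).comap fun ω => (Y ω, O ω)] =ᵐ[P] fun ω => f (Y ω) := by
  have hYO : Measurable fun ω => (Y ω, O ω) := hY.prodMk hO
  have hfi : Integrable (fun ω => f (Y ω)) P := integrable_condExp.congr hc
  have hzero {B : Set 𝓨} (hB : MeasurableSet B) : ∫ ω in Y ⁻¹' B, (v (W ω) - f (Y ω)) ∂P = 0 := by
    rw [integral_sub hV.integrableOn hfi.integrableOn,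
      ← setIntegral_condExp hY.comap_le hV ⟨B, hB, rfl⟩,
      setIntegral_congr_ae (hY hB) (hc.mono fun _ h _ => h), sub_self]
  refine (condExp_ae_eq_of_setIntegral_sub_eq_zero hYO hV hfi fun C hC => ?_).trans
    (.of_eq (condExp_of_stronglyMeasurable hYO.comap_le
      ((hf.comp measurable_fst).comp (comap_measurable fun ω => (Y ω, O ω))).stronglyMeasurable
      hfi))
  let G : 𝓞 → 𝓨 × 𝓥 → ℝ := fun o p =>
    {z : 𝓨 × 𝓥 | (z.1, o) ∈ C}.indicator (fun z => v z.2 - f z.1) p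
  have hG (ω : Ω) : G (O ω) (Y ω, W ω) =
      ((fun ω => (Y ω, O ω)) ⁻¹' C).indicator (fun ω => v (W ω) - f (Y ω)) ω := rfl
  have hGm : Measurable fun p : 𝓞 × (𝓨 × 𝓥) => G p.1 p.2 :=
    Measurable.indicator (by fun_prop) (measurableSet_preimage (by fun_prop) hC :
      MeasurableSet ((fun p : 𝓞 × (𝓨 × 𝓥) => (p.2.1, p.1)) ⁻¹' C))
  have hfubini := setIntegral_comp_eq_zero_of_indepFun hO.aemeasurable (hY.prodMk hW).aemeasurable
    hind.symm hGm (((hV.sub hfi).indicator (hYO hC)).congr (.of_forall hG))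
    (fun o => ?_) MeasurableSet.univ
  · rw [← integral_indicator (hYO hC)]
    simpa only [Set.preimage_univ, setIntegral_univ, hG] using hfubini
  · have hCo : MeasurableSet ((fun y => (y, o)) ⁻¹' C) := measurable_prodMk_right hC
    rw [← hzero hCo, ← integral_indicator (hY hCo)]
    rfl

theorem ae_integral_condDistrib_eq {κ : Type*} [Fintype κ] (hT : Measurable T) {W : Ω → κ → ℝ}
    (hW : ∀ j, Integrable (fun ω => W ω j) P) {f : 𝓣 → κ → ℝ} (hf : Measurable f)
    (hc : ∀ j, P[fun ω => W ω j | m𝓣.comap T] =ᵐ[P] fun ω => f (T ω) j) :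
    ∀ᵐ t ∂(P.map T), Integrable (fun v : κ → ℝ => v) (condDistrib W T P t) ∧
      ∫ v, v ∂(condDistrib W T P t) = f t := by
  have hWint : Integrable W P := .of_eval hW
  have hint : ∀ᵐ t ∂(P.map T), Integrable (fun v : κ → ℝ => v) (condDistrib W T P t) :=
    Integrable.condDistrib_ae_map (f := Prod.snd) hWint.aemeasurable
      ((integrable_map_measure measurable_snd.aestronglyMeasurable
        (hT.aemeasurable.prodMk hWint.aemeasurable)).2 hWint)
  have hmeas : Measurable fun t => ∫ v, v ∂(condDistrib W T P t) :=
    (StronglyMeasurable.integral_condDistrib (f := Prod.snd)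
      measurable_snd.stronglyMeasurable).measurable
  have hcond (j : κ) : P[fun ω => W ω j | m𝓣.comap T] =ᵐ[P]
      fun ω => ∫ v, v j ∂(condDistrib W T P (T ω)) :=
    condExp_ae_eq_integral_condDistrib hT hWint.aemeasurable
      (measurable_pi_apply j).stronglyMeasurable (hW j)
  refine hint.and ((ae_map_iff hT.aemeasurable (measurableSet_eq_fun hmeas hf)).2 ?_)
  filter_upwards [ae_of_ae_map hT.aemeasurable hint, ae_all_iff.2 hc, ae_all_iff.2 hcond]
    with ω hintω hcω hcondω
  funext j
  rw [eval_integral fun i => hintω.eval i, ← hcondω, hcω]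

end ConditionalExpectation

section Mixture

variable {ι : Type*} [Fintype ι] [DecidableEq ι] {Ω : Type*} [MeasurableSpace Ω] {P : Measure Ω}
  {V : Ω → ι → ℝ} {U : Ω → ℝ} {mu : ι → ℝ} {S : Matrix ι ι ℝ} {lam : ι → ℝ} {H : Measure ℝ}

theorem IsSMSN.integrable_comp_iff (h : IsSMSN P V U mu S lam H) (hS : S.PosDef)
    (hH : ∀ᵐ u ∂H, 0 < u) (hV : Measurable V) (hU : Measurable U) {F : ℝ × (ι → ℝ) → ℝ}
    (hF : Measurable F) :
    Integrable (fun ω => F (U ω, V ω)) P ↔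
      Integrable (fun p : ℝ × (ι → ℝ) => F (p.1, mu + (√p.1)⁻¹ • p.2))
        (H.prod (skewNormal S (CFC.sqrt S⁻¹ *ᵥ lam))) :=
  (integrable_map_measure hF.aestronglyMeasurable (hU.prodMk hV).aemeasurable).symm.trans <| by
    rw [h.map_joint_eq_map_prod hS hH]
    exact integrable_map_measure hF.aestronglyMeasurable
      (by fun_prop : Measurable fun p : ℝ × (ι → ℝ) => (p.1, mu + (√p.1)⁻¹ • p.2)).aemeasurable

theorem IsSMSN.setIntegral_comp_eq_zero [SFinite H] (h : IsSMSN P V U mu S lam H) (hS : S.PosDef)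
    (hH : ∀ᵐ u ∂H, 0 < u) (hV : Measurable V) (hU : Measurable U) {F : ℝ × (ι → ℝ) → ℝ}
    (hF : Measurable F) (hint : Integrable (fun ω => F (U ω, V ω)) P) {B : Set (ι → ℝ)}
    (hB : MeasurableSet B)
    (hzero : ∀ᵐ u ∂H, ∫ w in (fun w => mu + (√u)⁻¹ • w) ⁻¹' B, F (u, mu + (√u)⁻¹ • w)
      ∂(skewNormal S (CFC.sqrt S⁻¹ *ᵥ lam)) = 0) :
    ∫ ω in V ⁻¹' B, F (U ω, V ω) ∂P = 0 := by
  let G : ℝ × (ι → ℝ) → ℝ := (Prod.snd ⁻¹' B).indicator F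
  have hG : Measurable G := hF.indicator (measurable_snd hB)
  have hGint : Integrable (fun ω => G (U ω, V ω)) P := hint.indicator (hV hB)
  have haffine : Measurable fun p : ℝ × (ι → ℝ) => (p.1, mu + (√p.1)⁻¹ • p.2) := by fun_prop
  calc ∫ ω in V ⁻¹' B, F (U ω, V ω) ∂P
      = ∫ ω, G (U ω, V ω) ∂P := (integral_indicator (hV hB)).symm
    _ = ∫ p, G (p.1, mu + (√p.1)⁻¹ • p.2) ∂(H.prod (skewNormal S (CFC.sqrt S⁻¹ *ᵥ lam))) := by
      rw [← integral_map (hU.prodMk hV).aemeasurable hG.aestronglyMeasurable,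
        h.map_joint_eq_map_prod hS hH,
        integral_map haffine.aemeasurable hG.aestronglyMeasurable]
    _ = 0 := by
      rw [integral_prod _ ((h.integrable_comp_iff hS hH hV hU hG).1 hGint)]
      refine integral_eq_zero_of_ae (hzero.mono fun u hu => ?_)
      have hBu : MeasurableSet ((fun w : ι → ℝ => mu + (√u)⁻¹ • w) ⁻¹' B) :=
        measurableSet_preimage (by fun_prop) hB
      rw [← integral_indicator hBu] at hu
      exact hu

theorem IsSMSN.integrable_dotProduct_sub (h : IsSMSN P V U mu S lam H) (hS : S.PosDef)
    (hH : ∀ᵐ u ∂H, 0 < u) (hk : Integrable (fun u : ℝ => (√u)⁻¹) H) (hV : Measurable V)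
    (hU : Measurable U) (a : ι → ℝ) : Integrable (fun ω => a ⬝ᵥ (V ω - mu)) P := by
  have hmeas : Measurable fun p : ℝ × (ι → ℝ) => a ⬝ᵥ (p.2 - mu) :=
    (measurable_dotProduct a).comp (by fun_prop)
  refine (h.integrable_comp_iff hS hH hV hU hmeas).2 ?_
  simpa only [add_sub_cancel_left, dotProduct_smul, smul_eq_mul] using
    hk.mul_prod (integrable_dotProduct_skewNormal S (CFC.sqrt S⁻¹ *ᵥ lam) a)

end Mixture

section Prediction

variable {ι κ : Type*} [Fintype ι] [DecidableEq ι] [Fintype κ]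

/-- `u^{-1/2} W_Φ(u^{1/2} υ̃ᵀ (y - μ₁))`, whose conditional mean given the first block is `τ̃₋₁`. -/
def tauIntegrand (mu : ι ⊕ κ → ℝ) (S : Matrix (ι ⊕ κ) (ι ⊕ κ) ℝ) (υ : ι ⊕ κ → ℝ) (y : ι → ℝ)
    (u : ℝ) : ℝ :=
  (√u)⁻¹ * WPhi (√u * (marginalSkewness S υ ⬝ᵥ (y - mu ∘ Sum.inl)))

/-- `μ₂.₁(y) + τ̃₋₁(y) S₂₂.₁ υ₂ / √(1 + υ₂ᵀ S₂₂.₁ υ₂)`, the predictor of the second block from the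
value `y` of the first block `Y`, where `U` is the scale mixing variable. -/
def predictor {Ω : Type*} [MeasurableSpace Ω] (mu : ι ⊕ κ → ℝ) (S : Matrix (ι ⊕ κ) (ι ⊕ κ) ℝ)
    (υ : ι ⊕ κ → ℝ) (P : Measure Ω) [IsFiniteMeasure P] (Y : Ω → ι → ℝ) (U : Ω → ℝ)
    (y : ι → ℝ) : κ → ℝ :=
  regression mu S y +
    ((∫ u, tauIntegrand mu S υ y u ∂(condDistrib U Y P y)) / residualScale S υ) •
      (schurCompl S *ᵥ (υ ∘ Sum.inr))

variable {mu lam : ι ⊕ κ → ℝ} {S : Matrix (ι ⊕ κ) (ι ⊕ κ) ℝ} {υ : ι ⊕ κ → ℝ}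
  {Ω : Type*} [MeasurableSpace Ω] {P : Measure Ω}

theorem measurable_tauIntegrand :
    Measurable fun p : (ι → ℝ) × ℝ => tauIntegrand mu S υ p.1 p.2 :=
  Measurable.mul (by fun_prop) (measurable_WPhi.comp (Measurable.mul (by fun_prop)
    ((measurable_dotProduct _).comp (by fun_prop))))

theorem measurable_regression {κ : Type*} [Finite κ] {mu : ι ⊕ κ → ℝ}
    {S : Matrix (ι ⊕ κ) (ι ⊕ κ) ℝ} : Measurable (regression mu S) :=
  ((measurable_mulVec _).comp ((measurable_mulVec _).comp (by fun_prop))).const_add _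

theorem measurable_predictor [IsFiniteMeasure P] {Y : Ω → ι → ℝ} {U : Ω → ℝ} :
    Measurable (predictor mu S υ P Y U) :=
  measurable_regression.add (((StronglyMeasurable.integral_condDistrib
    measurable_tauIntegrand.stronglyMeasurable).measurable.div_const _).smul_const _)

theorem predictor_apply_eq_integral [IsFiniteMeasure P] {Y : Ω → ι → ℝ} {U : Ω → ℝ} {y : ι → ℝ}
    (hτ : Integrable (tauIntegrand mu S υ y) (condDistrib U Y P y)) (j : κ) :
    predictor mu S υ P Y U y j = ∫ u, (regression mu S y j + tauIntegrand mu S υ y u *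
      ((schurCompl S *ᵥ (υ ∘ Sum.inr)) j / residualScale S υ)) ∂(condDistrib U Y P y) := by
  rw [integral_add (integrable_const _) (hτ.mul_const _), integral_const, probReal_univ, one_smul,
    integral_mul_const, predictor, Pi.add_apply, Pi.smul_apply, smul_eq_mul, div_mul_eq_mul_div,
    ← mul_div_assoc]

theorem tauIntegrand_add_smul {u : ℝ} (hu : 0 < u) (w : ι ⊕ κ → ℝ) :
    tauIntegrand mu S υ ((mu + (√u)⁻¹ • w) ∘ Sum.inl) u =
      (√u)⁻¹ * WPhi (marginalSkewness S υ ⬝ᵥ (w ∘ Sum.inl)) := by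
  have hcentred : (mu + (√u)⁻¹ • w) ∘ Sum.inl - mu ∘ Sum.inl = (√u)⁻¹ • (w ∘ Sum.inl) :=
    add_sub_cancel_left _ _
  rw [tauIntegrand, hcentred, dotProduct_smul, smul_eq_mul,
    mul_inv_cancel_left₀ (Real.sqrt_pos.2 hu).ne']

variable [DecidableEq κ] {V : Ω → ι ⊕ κ → ℝ} {U : Ω → ℝ} {H : Measure ℝ}

theorem IsSMSN.integrable_tauIntegrand [SFinite H] (h : IsSMSN P V U mu S lam H) (hS : S.PosDef)
    (hH : ∀ᵐ u ∂H, 0 < u) (hk : Integrable (fun u : ℝ => (√u)⁻¹) H) (hV : Measurable V)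
    (hU : Measurable U) :
    Integrable (fun ω => tauIntegrand mu S (CFC.sqrt S⁻¹ *ᵥ lam) (V ω ∘ Sum.inl) (U ω)) P := by
  set υ := CFC.sqrt S⁻¹ *ᵥ lam
  have hmeas : Measurable fun p : ℝ × (ι ⊕ κ → ℝ) => tauIntegrand mu S υ (p.2 ∘ Sum.inl) p.1 :=
    measurable_tauIntegrand.comp ((measurable_comp_inl.comp measurable_snd).prodMk measurable_fst)
  refine (h.integrable_comp_iff hS hH hV hU hmeas).2 ?_
  have hpos : ∀ᵐ p ∂(H.prod (skewNormal S υ)), 0 < p.1 := Measure.quasiMeasurePreserving_fst.ae hH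
  exact (hk.mul_prod (integrable_WPhi_marginalSkewness hS υ)).congr
    (hpos.mono fun p hp => (tauIntegrand_add_smul hp p.2).symm)

theorem IsSMSN.ae_integrable_tauIntegrand [IsFiniteMeasure P] (h : IsSMSN P V U mu S lam H)
    (hS : S.PosDef) (hH : ∀ᵐ u ∂H, 0 < u) (hk : Integrable (fun u : ℝ => (√u)⁻¹) H)
    (hV : Measurable V) (hU : Measurable U) :
    ∀ᵐ y ∂(P.map fun ω => V ω ∘ Sum.inl), Integrable (tauIntegrand mu S (CFC.sqrt S⁻¹ *ᵥ lam) y)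
      (condDistrib U (fun ω => V ω ∘ Sum.inl) P y) := by
  have : IsFiniteMeasure H := h.map_mixing ▸ inferInstance
  exact ((integrable_map_measure measurable_tauIntegrand.aestronglyMeasurable
    ((measurable_comp_inl.comp hV).prodMk hU).aemeasurable).2
    (h.integrable_tauIntegrand hS hH hk hV hU)).condDistrib_ae_map hU.aemeasurable

theorem IsSMSN.setIntegral_residual_sub_tauIntegrand_eq_zero [SFinite H]
    (h : IsSMSN P V U mu S lam H) (hS : S.PosDef) (hH : ∀ᵐ u ∂H, 0 < u)
    (hk : Integrable (fun u : ℝ => (√u)⁻¹) H) (hV : Measurable V) (hU : Measurable U)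
    (hυ : υ = CFC.sqrt S⁻¹ *ᵥ lam) (j : κ) {B : Set (ι → ℝ)} (hB : MeasurableSet B) :
    ∫ ω in (fun ω => V ω ∘ Sum.inl) ⁻¹' B, ((residualMatrix S *ᵥ (V ω - mu)) j -
      tauIntegrand mu S υ (V ω ∘ Sum.inl) (U ω) *
        ((schurCompl S *ᵥ (υ ∘ Sum.inr)) j / residualScale S υ)) ∂P = 0 := by
  set c := (schurCompl S *ᵥ (υ ∘ Sum.inr)) j / residualScale S υ
  let F : ℝ × (ι ⊕ κ → ℝ) → ℝ := fun p =>
    (residualMatrix S *ᵥ (p.2 - mu)) j - tauIntegrand mu S υ (p.2 ∘ Sum.inl) p.1 * c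
  have hF : Measurable F :=
    ((measurable_dotProduct (residualMatrix S j)).comp (by fun_prop)).sub
      ((measurable_tauIntegrand.comp
        ((measurable_comp_inl.comp measurable_snd).prodMk measurable_fst)).mul_const c)
  have hint : Integrable (fun ω => F (U ω, V ω)) P :=
    (h.integrable_dotProduct_sub hS hH hk hV hU (residualMatrix S j)).sub
      ((hυ ▸ h.integrable_tauIntegrand hS hH hk hV hU).mul_const c)
  refine h.setIntegral_comp_eq_zero hS hH hV hU hF hint (measurable_comp_inl hB)
    (hH.mono fun u hu => ?_)
  have hFu (w : ι ⊕ κ → ℝ) : F (u, mu + (√u)⁻¹ • w) = (√u)⁻¹ * ((residualMatrix S *ᵥ w) j -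
      WPhi (marginalSkewness S υ ⬝ᵥ (w ∘ Sum.inl)) * c) := by
    simp only [F, add_sub_cancel_left, mulVec_smul, Pi.smul_apply, smul_eq_mul,
      tauIntegrand_add_smul hu]
    ring
  have hBu : MeasurableSet ((fun x : ι → ℝ => mu ∘ Sum.inl + (√u)⁻¹ • x) ⁻¹' B) :=
    measurableSet_preimage (by fun_prop) hB
  simp only [hFu, integral_const_mul]
  rw [← hυ]
  exact mul_eq_zero_of_right _ (setIntegral_residual_sub_WPhi_eq_zero hS υ j hBu)

theorem IsSMSN.integrable_apply [IsFiniteMeasure P] {ι : Type*} [Fintype ι] [DecidableEq ι]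
    {V : Ω → ι → ℝ} {mu lam : ι → ℝ} {S : Matrix ι ι ℝ} (h : IsSMSN P V U mu S lam H)
    (hS : S.PosDef) (hH : ∀ᵐ u ∂H, 0 < u) (hk : Integrable (fun u : ℝ => (√u)⁻¹) H)
    (hV : Measurable V) (hU : Measurable U) (i : ι) : Integrable (fun ω => V ω i) P := by
  have hcentred := h.integrable_dotProduct_sub hS hH hk hV hU (Pi.single i 1)
  simp only [single_one_dotProduct, Pi.sub_apply] at hcentred
  exact (hcentred.add (integrable_const (mu i))).congr (.of_forall fun ω => sub_add_cancel _ _)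

theorem IsSMSN.condExp_eq_predictor [IsFiniteMeasure P] (h : IsSMSN P V U mu S lam H)
    (hS : S.PosDef) (hH : ∀ᵐ u ∂H, 0 < u) (hk : Integrable (fun u : ℝ => (√u)⁻¹) H)
    (hV : Measurable V) (hU : Measurable U) (j : κ) :
    P[fun ω => V ω (Sum.inr j) | MeasurableSpace.pi.comap fun ω => V ω ∘ Sum.inl] =ᵐ[P]
      fun ω => predictor mu S (CFC.sqrt S⁻¹ *ᵥ lam) P (fun ω => V ω ∘ Sum.inl) U
        (V ω ∘ Sum.inl) j := by
  have : IsFiniteMeasure H := h.map_mixing ▸ inferInstance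
  set υ := CFC.sqrt S⁻¹ *ᵥ lam with hυ
  let Y : Ω → ι → ℝ := fun ω => V ω ∘ Sum.inl
  let c := (schurCompl S *ᵥ (υ ∘ Sum.inr)) j / residualScale S υ
  let F : (ι → ℝ) × ℝ → ℝ := fun p => regression mu S p.1 j + tauIntegrand mu S υ p.1 p.2 * c
  have hY : Measurable Y := measurable_comp_inl.comp hV
  have hF : Measurable F :=
    ((measurable_pi_apply j).comp (measurable_regression.comp measurable_fst)).add
      (measurable_tauIntegrand.mul_const c)
  have hresidual (ω : Ω) : V ω (Sum.inr j) - regression mu S (Y ω) j =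
      (residualMatrix S *ᵥ (V ω - mu)) j :=
    congrFun (sub_regression_eq_residualMatrix_mulVec mu (V ω) S) j
  have hVj : Integrable (fun ω => V ω (Sum.inr j)) P :=
    h.integrable_apply hS hH hk hV hU (Sum.inr j)
  have hregression : Integrable (fun ω => regression mu S (Y ω) j) P :=
    (hVj.sub (h.integrable_dotProduct_sub hS hH hk hV hU (residualMatrix S j))).congr
      (.of_forall fun ω => sub_eq_iff_eq_add.2 (sub_eq_iff_eq_add'.1 (hresidual ω)))
  have htau : Integrable (fun ω => tauIntegrand mu S υ (Y ω) (U ω)) P :=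
    h.integrable_tauIntegrand hS hH hk hV hU
  have hFint : Integrable (fun ω => F (Y ω, U ω)) P := hregression.add (htau.mul_const c)
  have hcond : P[fun ω => V ω (Sum.inr j) | MeasurableSpace.pi.comap Y] =ᵐ[P]
      P[fun ω => F (Y ω, U ω) | MeasurableSpace.pi.comap Y] := by
    refine condExp_ae_eq_of_setIntegral_sub_eq_zero hY hVj hFint fun B hB => ?_
    simp only [F, ← sub_sub, hresidual]
    exact h.setIntegral_residual_sub_tauIntegrand_eq_zero hS hH hk hV hU hυ j hB
  filter_upwards [hcond, condExp_prod_ae_eq_integral_condDistrib hY hU.aemeasurable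
    hF.stronglyMeasurable hFint, ae_of_ae_map hY.aemeasurable
    (h.ae_integrable_tauIntegrand hS hH hk hV hU)] with ω hω hω' htauω
  exact (hω.trans hω').trans (predictor_apply_eq_integral htauω j).symm

end Prediction

namespace Model

variable {l q m r : ℕ}

theorem posDef_Psi {M : Model l q m r} (hD : M.D.PosDef) (hSigma : M.Sigma.PosDef) : M.Psi.PosDef :=
  hSigma.add_posSemidef (by simpa using hD.posSemidef.mul_mul_conjTranspose_same M.Zstar)

variable (M : Model l q m r)

theorem sub_loc_inl (y : Fin m → ℝ) : y - M.loc ∘ Sum.inl = M.resid y := by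
  rw [resid, sub_sub]
  rfl

theorem regression_loc_Psi : regression M.loc M.Psi = M.mu2_1 := by
  ext1 y
  rw [regression, sub_loc_inl]
  rfl

theorem tauIntegrand_loc_Psi : SMSN.tauIntegrand M.loc M.Psi M.upsilon = M.tauIntegrand := by
  ext y u
  rw [SMSN.tauIntegrand, sub_loc_inl]
  rfl

theorem predictor_loc_Psi {Ω : Type*} [MeasurableSpace Ω] (P : Measure Ω) [IsFiniteMeasure P]
    (Y : Ω → Fin m → ℝ) (U : Ω → ℝ) :
    SMSN.predictor M.loc M.Psi M.upsilon P Y U = M.predictor P Y U := by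
  ext1 y
  rw [SMSN.predictor, regression_loc_Psi, tauIntegrand_loc_Psi]
  rfl

end Model

end SMSN

end

theorem mainTheorem5_general {ι : Type*} [Fintype ι] [DecidableEq ι] {r : ℕ}
    {mu lam : ι ⊕ Fin r → ℝ} {S : Matrix (ι ⊕ Fin r) (ι ⊕ Fin r) ℝ} (hS : S.PosDef)
    {H : Measure ℝ} (hH : ∀ᵐ u ∂H, 0 < u) (hk : Integrable (fun u : ℝ => (√u)⁻¹) H)
    {Ω : Type*} [MeasurableSpace Ω] {P : Measure Ω} [IsFiniteMeasure P]
    {Y : Ω → ι → ℝ} {Yp : Ω → Fin r → ℝ} {U : Ω → ℝ}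
    (hY : Measurable Y) (hYp : Measurable Yp) (hU : Measurable U)
    (hjoint : SMSN.IsSMSN P (fun ω => Sum.elim (Y ω) (Yp ω)) U mu S lam H)
    {υ : ι ⊕ Fin r → ℝ} (hυ : υ = CFC.sqrt S⁻¹ *ᵥ lam)
    {𝓞 : Type*} [MeasurableSpace 𝓞] {Yo : Ω → 𝓞}
    (hYo : Measurable Yo) (hind : IndepFun (fun ω => (Y ω, Yp ω)) Yo P) :
    (∀ᵐ y ∂(P.map Y),
      Integrable (fun v : Fin r → ℝ => v) (condDistrib Yp Y P y) ∧
      Integrable (SMSN.tauIntegrand mu S υ y) (condDistrib U Y P y) ∧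
      ∫ v, v ∂(condDistrib Yp Y P y) = SMSN.predictor mu S υ P Y U y) ∧
    SMSN.IsMinMSEPredictor P Yp (fun ω => (Y ω, Yo ω))
      (fun t => SMSN.predictor mu S υ P Y U t.1) ∧
    SMSN.IsMinMSEPredictor P Yp Y (SMSN.predictor mu S υ P Y U) := by
  subst hυ
  have hV : Measurable fun ω => Sum.elim (Y ω) (Yp ω) := measurable_pi_iff.2 fun
    | .inl i => (measurable_pi_apply i).comp hY
    | .inr j => (measurable_pi_apply j).comp hYp
  have hint (j : Fin r) : Integrable (fun ω => Yp ω j) P :=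
    hjoint.integrable_apply hS hH hk hV hU (Sum.inr j)
  have hcond (j : Fin r) := hjoint.condExp_eq_predictor hS hH hk hV hU j
  refine ⟨?_, ?_, SMSN.isMinMSEPredictor_of_condExp hY SMSN.measurable_predictor hint hcond⟩
  · filter_upwards [SMSN.ae_integral_condDistrib_eq hY hint SMSN.measurable_predictor hcond,
      hjoint.ae_integrable_tauIntegrand hS hH hk hV hU] with y hYpy htau
    exact ⟨hYpy.1, htau, hYpy.2⟩
  · exact SMSN.isMinMSEPredictor_of_condExp (hY.prodMk hYo)
      (SMSN.measurable_predictor.comp measurable_fst) hint fun j =>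
      SMSN.condExp_prodMk_of_indepFun hY hYp hYo hind (measurable_pi_apply j) (hint j)
        ((measurable_pi_apply j).comp SMSN.measurable_predictor) (hcond j)

theorem mainTheorem5 {l q m r : ℕ} (M : SMSN.Model l q m r)
    (hD : M.D.PosDef) (hSigma : M.Sigma.PosDef)
    (hH : IsProbabilityMeasure M.H) (hHpos : ∀ᵐ u ∂M.H, 0 < u)
    (hk : Integrable (fun u : ℝ => (√u)⁻¹) M.H)
    {Ω : Type*} [MeasurableSpace Ω] (P : Measure Ω) [IsProbabilityMeasure P]
    (Y : Ω → Fin m → ℝ) (Yp : Ω → Fin r → ℝ) (U : Ω → ℝ)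
    (hY : Measurable Y) (hYp : Measurable Yp) (hU : Measurable U)
    (hjoint : SMSN.IsSMSN P (fun ω => Sum.elim (Y ω) (Yp ω)) U M.loc M.Psi M.lamBar M.H)
    -- the observations of the other subjects
    {J : Type*} [Fintype J] (dim : J → ℕ) (Yo : Ω → (j : J) → Fin (dim j) → ℝ)
    (hYo : Measurable Yo) (hind : IndepFun (fun ω => (Y ω, Yp ω)) Yo P) :
    (∀ᵐ y ∂(P.map Y),
      Integrable (fun v : Fin r → ℝ => v) (condDistrib Yp Y P y) ∧
      Integrable (M.tauIntegrand y) (condDistrib U Y P y) ∧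
      ∫ v, v ∂(condDistrib Yp Y P y) =
        M.mu2_1 y + (M.tauTilde P Y U y / M.scale) • (M.Psi22_1 *ᵥ M.upsilon2)) ∧
    SMSN.IsMinMSEPredictor P Yp (fun ω => (Y ω, Yo ω)) (fun t => M.predictor P Y U t.1) ∧
    SMSN.IsMinMSEPredictor P Yp Y (M.predictor P Y U) := by
  have hgeneral := mainTheorem5_general (SMSN.Model.posDef_Psi hD hSigma) hHpos hk hY hYp hU hjoint
    (υ := M.upsilon) rfl hYo hind
  rw [M.tauIntegrand_loc_Psi, M.predictor_loc_Psi] at hgeneral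
  exact hgeneral
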